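/- All graphs are finite and simple, with vertices taken from a fixed infinite set $U$; $H\le K$ means that $H$ is a subgraph of $K$. Let $K_m$ denote the complete graph on a set of $m$ vertices, $C_4$ the cycle of length $4$, and $P_4$ the path with $4$ vertices and $3$ edges. For graphs $K$ and $\Gamma$, a $(K,\Gamma)$-design is a set of subgraphs of $K$, each isomorphic to $\Gamma$, whose edge sets partition the edge set of $K$. A $(K_m,\Gamma)$-design is also called a $\Gamma$-design of order $m$. A design $\mathcal B$ can be down-linked to a design $\mathcal B'$ if there is a function $f:\mathcal B\to\mathcal B'$ such that $f(B)\le B$ for every $B\in\mathcal B$. Let $\mathcal L_1C_4(v)$ be the set of all $n$ such that some $C_4$-design of order $v$ can be down-linked to a $P_4$-design of order $n$, and let $\mathcal L_2C_4(v)$ be the set of all $n$ such that every $C_4$-design of order $v$ can be down-linked to a $P_4$-design of order $n$. **Theorem.** Let $v>1$ be an integer for which a $C_4$-design of order $v$ exists. Then $$\mathcal L_1C_4(v)=\{n\ge v : n\equiv 0,1\ (\mathrm{mod}\ 3)\}$$ and $$\{n\ge v+2 : n\equiv 0,1\ (\mathrm{mod}\ 3)\}\subseteq\mathcal L_2C_4(v)\subseteq\{n\ge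 v : n\equiv 0,1\ (\mathrm{mod}\ 3)\}.$$ -/

import Mathlib

/-- A finite or infinite graph whose vertices are taken from the pool `U`: a vertex set together
with an adjacency relation on it, ordered by the relation `H ≤ K` of being a subgraph. -/
abbrev GraphIn (U : Type*) := (⊤ : SimpleGraph U).Subgraph

/-- The complete graph with vertex set `X`. -/
def completeOn {U : Type*} (X : Finset U) : GraphIn U :=
  (⊤ : (⊤ : SimpleGraph U).Subgraph).induce (X : Set U)

/-- `𝓑` is a `(K, Γ)`-design: a set of subgraphs of `K`, each of them isomorphic to `Γ`, whose
edges partition the edge set of `K`. -/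
structure IsDesign {U W : Type*} (K : GraphIn U) (Γ : SimpleGraph W) (𝓑 : Set (GraphIn U)) :
    Prop where
  le : ∀ B ∈ 𝓑, B ≤ K
  iso : ∀ B ∈ 𝓑, Nonempty (B.coe ≃g Γ)
  partition : ∀ e ∈ K.edgeSet, ∃! B, B ∈ 𝓑 ∧ e ∈ B.edgeSet

/-- `𝓑` can be down-linked to `𝓑'`: there is a function `f : 𝓑 → 𝓑'` such that `f B` is a
subgraph of `B` for every `B ∈ 𝓑`. -/
def CanDownLink {U : Type*} (𝓑 𝓑' : Set (GraphIn U)) : Prop :=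
  ∃ f : 𝓑 → 𝓑', ∀ B : 𝓑, (f B : GraphIn U) ≤ (B : GraphIn U)

/-- `v` is admissible for `Γ`: there is a `Γ`-design of order `v`, that is, a `(K_v, Γ)`-design. -/
def Admissible (U : Type*) {W : Type*} (Γ : SimpleGraph W) (v : ℕ) : Prop :=
  ∃ (X : Finset U) (𝓑 : Set (GraphIn U)), X.card = v ∧ IsDesign (completeOn X) Γ 𝓑

/-- The set of all `n` such that some `Γ`-design of order `v` can be down-linked to a
`Γ'`-design of order `n`. -/
def spectrumOne (U : Type*) {W W' : Type*} (Γ : SimpleGraph W) (Γ' : SimpleGraph W') (v : ℕ) :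
    Set ℕ :=
  {n | ∃ (X : Finset U) (𝓑 : Set (GraphIn U)), X.card = v ∧ IsDesign (completeOn X) Γ 𝓑 ∧
    ∃ (Y : Finset U) (𝓑' : Set (GraphIn U)), Y.card = n ∧ IsDesign (completeOn Y) Γ' 𝓑' ∧
      CanDownLink 𝓑 𝓑'}

/-- The set of all `n` such that every `Γ`-design of order `v` can be down-linked to a
`Γ'`-design of order `n`. -/
def spectrumTwo (U : Type*) {W W' : Type*} (Γ : SimpleGraph W) (Γ' : SimpleGraph W') (v : ℕ) :
    Set ℕ :=
  {n | ∀ (X : Finset U) (𝓑 : Set (GraphIn U)), X.card = v → IsDesign (completeOn X) Γ 𝓑 →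
    ∃ (Y : Finset U) (𝓑' : Set (GraphIn U)), Y.card = n ∧ IsDesign (completeOn Y) Γ' 𝓑' ∧
      CanDownLink 𝓑 𝓑'}

/-- The cycle `C₄`. -/
abbrev C4 : SimpleGraph (Fin 4) := SimpleGraph.cycleGraph 4

/-- The path `P₄` with four vertices and three edges. -/
abbrev P4 : SimpleGraph (Fin 4) := SimpleGraph.pathGraph 4

/-! Upper bounds: a copy of `P4` inside a copy of `C4` is spanning, so a down-link forces every
vertex of the first design into the second, whence `n ≥ v`. Counting edges gives `3 ∣ n.choose 2`,
that is, `n ≡ 0, 1` mod 3.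

For `n ≥ v + 2`, delete an arbitrary `P4` from each cycle and adjoin `n - v` new points, two of
which are called `a` and `b`. The edges of the larger complete graph not yet used form a graph in
which `a` and `b` are adjacent to each other and to all other vertices, and their number is
divisible by 3. Every such graph except the triangle decomposes into copies of `P4`
(`IsJoin.pathDec`). The induction allows isolated vertices and removes pieces that keep this shape,
according to what is left outside `a` and `b`: a `P4`, a triangle component, two leaves of a star,
or three components of a matching. If a removal would leave the bad triangle, the triangle is
decomposed together with the removed piece. All finitely many small graphs are given by explicit
paths (`pathDec_of_paths`).

For the first spectrum only `n = v` and `n = v + 1` remain, and one good design suffices. Counting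
edges and degrees gives `v = 8t + 1`, and the cyclic design on `ZMod (8 * t + 1)` has base cycles
with differences `4i+1, ..., 4i+4` (`isDesign_cyclic`). Deleting the edge of difference `4i+1` from
each cycle leaves the differences `1, 5, 9, ...`. Three consecutive ones are covered by translates
of one zigzag path (`pathDec_leftover_triples`). The first one or two, with the star at the new
point when `n = v + 1`, are covered directly according to `t` mod 3. -/

/-! ### Copies of `P4` and `C4` as traces of injective 4-tuples -/

section Blocks

variable {U : Type*}

open Function

/-- The copy of `Γ` in the complete graph on `U` traced out by `p`. -/
def blockOf (Γ : SimpleGraph (Fin 4)) (p : Fin 4 → U) (hp : Injective p) : GraphIn U where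
  verts := Set.range p
  Adj x y := ∃ i j, Γ.Adj i j ∧ p i = x ∧ p j = y
  adj_sub := by
    rintro x y ⟨i, j, h, rfl, rfl⟩
    exact fun e => h.ne (hp e)
  edge_vert := by
    rintro x y ⟨i, j, h, rfl, rfl⟩
    exact ⟨i, rfl⟩
  symm := ⟨by
    rintro x y ⟨i, j, h, rfl, rfl⟩
    exact ⟨j, i, h.symm, rfl, rfl⟩⟩

lemma blockOf_iso (Γ : SimpleGraph (Fin 4)) (p : Fin 4 → U) (hp : Injective p) :
    Nonempty ((blockOf Γ p hp).coe ≃g Γ) := by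
  refine ⟨SimpleGraph.Iso.symm ⟨Equiv.ofInjective p hp, ?_⟩⟩
  intro i j
  constructor
  · rintro ⟨i', j', h, hi, hj⟩
    rw [hp hi, hp hj] at h
    exact h
  · intro h
    exact ⟨i, j, h, rfl, rfl⟩

lemma exists_eq_blockOf {Γ : SimpleGraph (Fin 4)} {B : GraphIn U} (h : Nonempty (B.coe ≃g Γ)) :
    ∃ (p : Fin 4 → U) (hp : Injective p), B = blockOf Γ p hp := by
  obtain ⟨φ⟩ := h
  refine ⟨fun i => (φ.symm i : U), fun i j hij => φ.symm.injective (Subtype.ext hij), ?_⟩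
  refine SimpleGraph.Subgraph.ext ?_ ?_
  · ext x
    constructor
    · intro hx
      exact ⟨φ ⟨x, hx⟩, by simp⟩
    · rintro ⟨i, rfl⟩
      exact (φ.symm i).2
  · ext x y
    constructor
    · intro hxy
      refine ⟨φ ⟨x, B.edge_vert hxy⟩, φ ⟨y, B.edge_vert hxy.symm⟩, ?_, by simp, by simp⟩
      rw [φ.map_adj_iff]
      exact hxy
    · rintro ⟨i, j, hij, rfl, rfl⟩
      rw [← φ.symm.map_adj_iff] at hij
      exact hij

lemma mem_edgeSet_blockOf_P4 {p : Fin 4 → U} {hp : Injective p} {e : Sym2 U} :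
    e ∈ (blockOf P4 p hp).edgeSet ↔ e = s(p 0, p 1) ∨ e = s(p 1, p 2) ∨ e = s(p 2, p 3) := by
  induction e with | _ x y =>
  rw [SimpleGraph.Subgraph.mem_edgeSet]
  simp only [blockOf, SimpleGraph.pathGraph_adj, Sym2.eq_iff]
  constructor
  · rintro ⟨i, j, h, rfl, rfl⟩
    fin_cases i <;> fin_cases j <;> simp at h ⊢
  · rintro ((⟨rfl, rfl⟩ | ⟨rfl, rfl⟩) | (⟨rfl, rfl⟩ | ⟨rfl, rfl⟩) | (⟨rfl, rfl⟩ | ⟨rfl, rfl⟩))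
    exacts [⟨0, 1, by simp⟩, ⟨1, 0, by simp⟩, ⟨1, 2, by simp⟩, ⟨2, 1, by simp⟩, ⟨2, 3, by simp⟩,
      ⟨3, 2, by simp⟩]

lemma mem_edgeSet_blockOf_C4 {p : Fin 4 → U} {hp : Injective p} {e : Sym2 U} :
    e ∈ (blockOf C4 p hp).edgeSet ↔
      e = s(p 0, p 1) ∨ e = s(p 1, p 2) ∨ e = s(p 2, p 3) ∨ e = s(p 3, p 0) := by
  have key : ∀ i j : Fin 4, C4.Adj i j ↔ s(i, j) = s(0, 1) ∨ s(i, j) = s(1, 2) ∨ s(i, j) = s(2, 3) ∨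
      s(i, j) = s(3, 0) := by
    decide
  induction e with | _ x y =>
  rw [SimpleGraph.Subgraph.mem_edgeSet]
  constructor
  · rintro ⟨i, j, h, rfl, rfl⟩
    have := (key i j).1 h
    rcases this with h | h | h | h <;>
      (have h' := congrArg (Sym2.map p) h; simp only [Sym2.map_mk] at h'; simp [h'])
  · have : ∀ i j, C4.Adj i j → s(x, y) = s(p i, p j) → (blockOf C4 p hp).Adj x y := by
      intro i j h hxy
      rcases Sym2.eq_iff.1 hxy with ⟨rfl, rfl⟩ | ⟨rfl, rfl⟩
      exacts [⟨i, j, h, rfl, rfl⟩, ⟨j, i, h.symm, rfl, rfl⟩]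
    rintro (h | h | h | h)
    exacts [this 0 1 (by decide) h, this 1 2 (by decide) h, this 2 3 (by decide) h,
      this 3 0 (by decide) h]

/-- The path on the same tuple drops only the closing edge from `p 3` to `p 0`. -/
lemma blockOf_P4_le_C4 (p : Fin 4 → U) (hp : Injective p) : blockOf P4 p hp ≤ blockOf C4 p hp := by
  refine ⟨le_rfl, ?_⟩
  intro x y h
  rw [← SimpleGraph.Subgraph.mem_edgeSet, mem_edgeSet_blockOf_P4] at h
  rw [← SimpleGraph.Subgraph.mem_edgeSet, mem_edgeSet_blockOf_C4]
  tauto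

lemma verts_blockOf (Γ : SimpleGraph (Fin 4)) (p : Fin 4 → U) (hp : Injective p) :
    (blockOf Γ p hp).verts = Set.range p := rfl

lemma mem_edgeSet_completeOn {X : Finset U} {x y : U} :
    s(x, y) ∈ (completeOn X).edgeSet ↔ x ∈ X ∧ y ∈ X ∧ x ≠ y := by
  rw [SimpleGraph.Subgraph.mem_edgeSet]
  simp [completeOn]

/-- A block without isolated vertices all of whose edges lie in `K` is a subgraph of `K`. -/
lemma le_of_edgeSet_subset {K B : GraphIn U} (hB : ∀ x ∈ B.verts, ∃ y, B.Adj x y)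
    (h : B.edgeSet ⊆ K.edgeSet) : B ≤ K := by
  have hadj : ∀ x y, B.Adj x y → K.Adj x y := fun x y hxy =>
    SimpleGraph.Subgraph.mem_edgeSet.1 (h (SimpleGraph.Subgraph.mem_edgeSet.2 hxy))
  refine ⟨fun x hx => ?_, fun x y => hadj x y⟩
  obtain ⟨y, hy⟩ := hB x hx
  exact K.edge_vert (hadj x y hy)

lemma exists_adj_blockOf (Γ : SimpleGraph (Fin 4)) (hΓ : ∀ i, ∃ j, Γ.Adj i j) {B : GraphIn U}
    (h : Nonempty (B.coe ≃g Γ)) : ∀ x ∈ B.verts, ∃ y, B.Adj x y := by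
  obtain ⟨p, hp, rfl⟩ := exists_eq_blockOf h
  rintro _ ⟨i, rfl⟩
  obtain ⟨j, hj⟩ := hΓ i
  exact ⟨p j, i, j, hj, rfl, rfl⟩

lemma exists_adj_P4 {B : GraphIn U} (h : Nonempty (B.coe ≃g P4)) : ∀ x ∈ B.verts, ∃ y, B.Adj x y :=
  exists_adj_blockOf P4 (by
    intro i
    fin_cases i
    exacts [⟨1, by simp [SimpleGraph.pathGraph_adj]⟩, ⟨2, by simp [SimpleGraph.pathGraph_adj]⟩,
      ⟨3, by simp [SimpleGraph.pathGraph_adj]⟩, ⟨2, by simp [SimpleGraph.pathGraph_adj]⟩]) h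

lemma exists_adj_C4 {B : GraphIn U} (h : Nonempty (B.coe ≃g C4)) : ∀ x ∈ B.verts, ∃ y, B.Adj x y :=
  exists_adj_blockOf C4 (by decide) h

lemma ncard_edgeSet_P4 {B : GraphIn U} (h : Nonempty (B.coe ≃g P4)) : B.edgeSet.ncard = 3 := by
  obtain ⟨p, hp, rfl⟩ := exists_eq_blockOf h
  have : (blockOf P4 p hp).edgeSet = {s(p 0, p 1), s(p 1, p 2), s(p 2, p 3)} := by
    ext e
    rw [mem_edgeSet_blockOf_P4]
    rfl
  rw [this, Set.ncard_eq_three]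
  refine ⟨_, _, _, ?_, ?_, ?_, rfl⟩ <;> simp [hp.eq_iff]

lemma ncard_edgeSet_C4 {B : GraphIn U} (h : Nonempty (B.coe ≃g C4)) : B.edgeSet.ncard = 4 := by
  classical
  obtain ⟨p, hp, rfl⟩ := exists_eq_blockOf h
  have : (blockOf C4 p hp).edgeSet =
      (({s(p 0, p 1), s(p 1, p 2), s(p 2, p 3), s(p 3, p 0)} : Finset (Sym2 U)) :
        Set (Sym2 U)) := by
    ext e
    rw [mem_edgeSet_blockOf_C4]
    simp
  rw [this, Set.ncard_coe_finset]
  rw [Finset.card_insert_of_notMem, Finset.card_insert_of_notMem, Finset.card_insert_of_notMem,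
    Finset.card_singleton] <;> simp [hp.eq_iff]

lemma ncard_neighborSet_C4 {B : GraphIn U} (h : Nonempty (B.coe ≃g C4)) {x : U} (hx : x ∈ B.verts) :
    (B.neighborSet x).ncard = 2 := by
  obtain ⟨p, hp, rfl⟩ := exists_eq_blockOf h
  obtain ⟨i, rfl⟩ := hx
  have : (blockOf C4 p hp).neighborSet (p i) = {p (i + 1), p (i - 1)} := by
    ext y
    have key : ∀ i j : Fin 4, C4.Adj i j ↔ j = i + 1 ∨ j = i - 1 := by decide
    rw [SimpleGraph.Subgraph.mem_neighborSet]
    constructor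
    · rintro ⟨i', j, hij, hi, rfl⟩
      rw [hp hi, key] at hij
      rcases hij with rfl | rfl <;> simp
    · rintro (rfl | rfl)
      exacts [⟨i, i + 1, (key _ _).2 (by simp), rfl, rfl⟩, ⟨i, i - 1, (key _ _).2 (by simp), rfl, rfl⟩]
  rw [this, Set.ncard_pair]
  rw [hp.ne_iff]
  clear this
  revert i
  decide

end Blocks

/-! ### Divisibility by counting over blocks -/

section Counting

open Function

/-- The map sending an element to its block has fibres of size `m`. Only nonempty traces need that
size, so the lemma also covers neighbours of a fixed vertex, which many blocks avoid. -/
lemma dvd_card_of_partition {α β : Type*} {m : ℕ} (s : Finset α) (𝓑 : Set β) (S : β → Set α)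
    (h : ∀ e ∈ s, ∃! B, B ∈ 𝓑 ∧ e ∈ S B) (hsub : ∀ B ∈ 𝓑, S B ⊆ s)
    (hc : ∀ B ∈ 𝓑, (S B).Nonempty → (S B).ncard = m) : m ∣ s.card := by
  classical
  choose g hg hu using fun e : s => h e e.2
  rw [← s.card_attach, Finset.card_eq_sum_card_image g]
  refine Finset.dvd_sum fun B hB => ?_
  obtain ⟨e, -, rfl⟩ := Finset.mem_image.1 hB
  have hge := hg e
  have : S (g e) =
      ((s.attach.filter fun e' => g e' = g e).map (Embedding.subtype _) : Finset α) := by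
    ext x
    simp only [Finset.coe_map, Finset.coe_filter, Set.mem_image]
    constructor
    · intro hx
      have hxs := hsub _ hge.1 hx
      exact ⟨⟨x, hxs⟩, ⟨Finset.mem_attach _ _, (hu ⟨x, hxs⟩ (g e) ⟨hge.1, hx⟩).symm⟩, rfl⟩
    · rintro ⟨y, ⟨-, hy⟩, rfl⟩
      rw [← hy]
      exact (hg y).2
  have hcard := hc _ hge.1 ⟨_, hge.2⟩
  rw [this, Set.ncard_coe_finset, Finset.card_map] at hcard
  rw [hcard]

end Counting

/-! ### Necessary conditions, path decompositions, and links from decompositions -/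

section Designs

variable {U : Type*}

open Function

/-- The edges of the complete graph on `X`. -/
def completeEdges [DecidableEq U] (X : Finset U) : Finset (Sym2 U) :=
  X.offDiag.image (uncurry Sym2.mk)

lemma mem_completeEdges [DecidableEq U] {X : Finset U} {x y : U} :
    s(x, y) ∈ completeEdges X ↔ x ∈ X ∧ y ∈ X ∧ x ≠ y := by
  simp only [completeEdges, Finset.mem_image, Finset.mem_offDiag, Prod.exists, uncurry, Sym2.eq_iff]
  constructor
  · rintro ⟨a, b, ⟨ha, hb, hab⟩, ⟨rfl, rfl⟩ | ⟨rfl, rfl⟩⟩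
    exacts [⟨ha, hb, hab⟩, ⟨hb, ha, hab.symm⟩]
  · intro h
    exact ⟨x, y, h, Or.inl ⟨rfl, rfl⟩⟩

lemma edgeSet_completeOn [DecidableEq U] (X : Finset U) :
    (completeOn X).edgeSet = completeEdges X := by
  ext e
  induction e with | _ x y =>
  rw [mem_edgeSet_completeOn, Finset.mem_coe, mem_completeEdges]

lemma IsDesign.dvd_choose {W : Type*} {Γ : SimpleGraph W} {X : Finset U} {𝓑 : Set (GraphIn U)}
    (h : IsDesign (completeOn X) Γ 𝓑) {m : ℕ}
    (hm : ∀ B : GraphIn U, Nonempty (B.coe ≃g Γ) → B.edgeSet.ncard = m) : m ∣ X.card.choose 2 := by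
  classical
  rw [← Sym2.card_image_offDiag]
  refine dvd_card_of_partition (completeEdges X) 𝓑 (fun B => B.edgeSet) (fun e he => ?_)
    (fun B hB => ?_) (fun B hB _ => hm B (h.iso B hB))
  · refine h.partition e ?_
    rwa [edgeSet_completeOn]
  · rw [← edgeSet_completeOn]
    exact SimpleGraph.Subgraph.edgeSet_mono (h.le B hB)

lemma IsDesign.exists_mem {W : Type*} {Γ : SimpleGraph W} {X : Finset U} {𝓑 : Set (GraphIn U)}
    (h : IsDesign (completeOn X) Γ 𝓑) {x y : U} (hx : x ∈ X) (hy : y ∈ X) (hxy : x ≠ y) :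
    ∃! B, B ∈ 𝓑 ∧ B.Adj x y := by
  simpa using h.partition s(x, y) (mem_edgeSet_completeOn.2 ⟨hx, hy, hxy⟩)

lemma IsDesign.two_dvd {X : Finset U} {𝓑 : Set (GraphIn U)}
    (h : IsDesign (completeOn X) C4 𝓑) (hX : X.Nonempty) : 2 ∣ X.card - 1 := by
  classical
  obtain ⟨x, hx⟩ := hX
  rw [← Finset.card_erase_of_mem hx]
  refine dvd_card_of_partition (X.erase x) 𝓑 (fun B => B.neighborSet x) (fun y hy => ?_)
    (fun B hB y hy => ?_) (fun B hB hne => ?_)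
  · rw [Finset.mem_erase] at hy
    exact h.exists_mem hx hy.2 hy.1.symm
  · have := (h.le B hB).2 hy
    rw [← SimpleGraph.Subgraph.mem_edgeSet, mem_edgeSet_completeOn] at this
    simpa [this.2.1] using this.2.2.symm
  · obtain ⟨y, hy⟩ := hne
    exact ncard_neighborSet_C4 (h.iso B hB) (B.edge_vert hy)

lemma two_mul_choose_two (n : ℕ) : 2 * n.choose 2 = n * (n - 1) := by
  rw [Nat.choose_two_right]
  exact Nat.mul_div_cancel' (by
    rcases n with _ | n
    · simp
    · rw [Nat.add_sub_cancel, mul_comm]; exact (Nat.even_mul_succ_self n).two_dvd)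

/-- Each cycle through a vertex uses two of its edges, so the order is `2k + 1`. The edge count `(2k
+ 1)k` is divisible by 4, and `2k + 1` is odd, so `4 ∣ k`. -/
lemma IsDesign.exists_eq_eight_mul {X : Finset U} {𝓑 : Set (GraphIn U)}
    (h : IsDesign (completeOn X) C4 𝓑) (hX : X.Nonempty) : ∃ t, X.card = 8 * t + 1 := by
  obtain ⟨k, hk⟩ := h.two_dvd hX
  obtain ⟨l, hl⟩ := h.dvd_choose fun B hB => ncard_edgeSet_C4 hB
  have h2 := two_mul_choose_two X.card
  have hpos := hX.card_pos
  have hc : X.card = 2 * k + 1 := by omega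
  rw [hl, hc, Nat.add_sub_cancel] at h2
  have h4 : 4 * l = (2 * k + 1) * k := by nlinarith
  have : 4 ∣ (2 * k + 1) * k := ⟨l, h4.symm⟩
  have hcop : Nat.Coprime 4 (2 * k + 1) := by
    rw [show 4 = 2 ^ 2 by norm_num]
    exact Nat.Coprime.pow_left 2 (by simp)
  obtain ⟨t, ht⟩ := hcop.dvd_of_dvd_mul_left this
  exact ⟨t, by omega⟩

lemma mod_three_of_dvd_choose {n : ℕ} (h : 3 ∣ n.choose 2) : n ≡ 0 [MOD 3] ∨ n ≡ 1 [MOD 3] := by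
  have h2 : 3 ∣ n * (n - 1) := by
    rw [← two_mul_choose_two]
    exact h.mul_left 2
  unfold Nat.ModEq
  rcases (Nat.Prime.dvd_mul Nat.prime_three).1 h2 with h | h <;> omega

lemma dvd_choose_of_mod_three {n : ℕ} (h : n ≡ 0 [MOD 3] ∨ n ≡ 1 [MOD 3]) : 3 ∣ n.choose 2 := by
  have h2 : 3 ∣ 2 * n.choose 2 := by
    rw [two_mul_choose_two]
    unfold Nat.ModEq at h
    rcases h with h | h
    · exact Dvd.dvd.mul_right (by omega) _
    · exact Dvd.dvd.mul_left (by omega) _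
  omega

/-- Both graphs have exactly four vertices. -/
lemma verts_eq_of_le {B P : GraphIn U} (hB : Nonempty (B.coe ≃g C4)) (hP : Nonempty (P.coe ≃g P4))
    (hle : P ≤ B) : P.verts = B.verts := by
  obtain ⟨p, hp, rfl⟩ := exists_eq_blockOf hB
  obtain ⟨q, hq, rfl⟩ := exists_eq_blockOf hP
  refine Set.eq_of_subset_of_ncard_le hle.1 ?_ (Set.finite_range p)
  rw [verts_blockOf, verts_blockOf, ← Set.image_univ, ← Set.image_univ,
    Set.ncard_image_of_injective _ hp, Set.ncard_image_of_injective _ hq]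

lemma subset_of_canDownLink {X Y : Finset U} {𝓑 𝓑' : Set (GraphIn U)}
    (h : IsDesign (completeOn X) C4 𝓑) (h' : IsDesign (completeOn Y) P4 𝓑') (hX : 1 < X.card)
    (hf : CanDownLink 𝓑 𝓑') : X ⊆ Y := by
  obtain ⟨f, hf⟩ := hf
  intro x hx
  obtain ⟨y, hy, hyx⟩ := Finset.exists_mem_ne hX x
  obtain ⟨B, ⟨hB, hxy⟩, -⟩ := h.exists_mem hx hy hyx.symm
  have hv := verts_eq_of_le (h.iso B hB) (h'.iso _ (f ⟨B, hB⟩).2) (hf ⟨B, hB⟩)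
  have hxB := B.edge_vert hxy
  rw [← hv] at hxB
  exact (h'.le _ (f ⟨B, hB⟩).2).1 hxB

lemma spectrumOne_subset {v : ℕ} (hv : 1 < v) :
    spectrumOne U C4 P4 v ⊆ {n : ℕ | v ≤ n ∧ (n ≡ 0 [MOD 3] ∨ n ≡ 1 [MOD 3])} := by
  rintro n ⟨X, 𝓑, rfl, h, Y, 𝓑', rfl, h', hf⟩
  exact ⟨Finset.card_le_card (subset_of_canDownLink h h' hv hf),
    mod_three_of_dvd_choose (h'.dvd_choose fun B hB => ncard_edgeSet_P4 hB)⟩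

/-- Without admissibility the universal condition would hold vacuously. -/
lemma spectrumTwo_subset_spectrumOne {v : ℕ} (hadm : Admissible U C4 v) :
    spectrumTwo U C4 P4 v ⊆ spectrumOne U C4 P4 v := by
  intro n hn
  obtain ⟨X, 𝓑, hX, h⟩ := hadm
  exact ⟨X, 𝓑, hX, h, hn X 𝓑 hX h⟩

/-- The edges in `E` can be partitioned into copies of `P₄`. -/
def PathDec (E : Set (Sym2 U)) : Prop :=
  ∃ 𝓟 : Set (GraphIn U), (∀ B ∈ 𝓟, Nonempty (B.coe ≃g P4)) ∧ (∀ B ∈ 𝓟, B.edgeSet ⊆ E) ∧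
    ∀ e ∈ E, ∃! B, B ∈ 𝓟 ∧ e ∈ B.edgeSet

lemma PathDec.iUnion {ι : Sort*} {F : ι → Set (Sym2 U)} (h : ∀ i, PathDec (F i))
    (hF : ∀ i j e, e ∈ F i → e ∈ F j → i = j) : PathDec (⋃ i, F i) := by
  choose 𝓟 h1 h2 h3 using h
  refine ⟨⋃ i, 𝓟 i, ?_, ?_, ?_⟩
  · intro B hB
    obtain ⟨i, hi⟩ := Set.mem_iUnion.1 hB
    exact h1 i B hi
  · intro B hB
    obtain ⟨i, hi⟩ := Set.mem_iUnion.1 hB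
    exact (h2 i B hi).trans (Set.subset_iUnion _ _)
  · intro e he
    obtain ⟨i, hi⟩ := Set.mem_iUnion.1 he
    obtain ⟨B, hB, hu⟩ := h3 i e hi
    refine ⟨B, ⟨Set.mem_iUnion.2 ⟨i, hB.1⟩, hB.2⟩, ?_⟩
    rintro C ⟨hC, heC⟩
    obtain ⟨j, hj⟩ := Set.mem_iUnion.1 hC
    obtain rfl := hF i j e hi (h2 j C hj heC)
    exact hu C ⟨hj, heC⟩

lemma PathDec.union {E F : Set (Sym2 U)} (hE : PathDec E) (hF : PathDec F) (h : Disjoint E F) :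
    PathDec (E ∪ F) := by
  rw [Set.union_eq_iUnion]
  refine PathDec.iUnion (fun b => by cases b <;> assumption) ?_
  rintro (_ | _) (_ | _) e he he'
  exacts [rfl, (Set.disjoint_left.1 h he' he).elim, (Set.disjoint_left.1 h he he').elim, rfl]

lemma pathDec_empty : PathDec (∅ : Set (Sym2 U)) := ⟨∅, by simp⟩

lemma PathDec.of_diff {P E : Set (Sym2 U)} (hP : PathDec P) (hsub : P ⊆ E) (h : PathDec (E \ P)) :
    PathDec E := by
  rw [← Set.union_sdiff_cancel hsub]
  exact hP.union h Set.disjoint_sdiff_right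

lemma injective_cons₄ {a b c d : U} (h : [a, b, c, d].Nodup) : Injective ![a, b, c, d] := by
  have := List.nodup_iff_injective_get.1 h
  convert! this using 1
  ext i
  fin_cases i <;> rfl

lemma pathDec_path {a b c d : U} (h : [a, b, c, d].Nodup) :
    PathDec {s(a, b), s(b, c), s(c, d)} := by
  have hp := injective_cons₄ h
  refine ⟨{blockOf P4 _ hp}, ?_, ?_, ?_⟩
  · rintro _ rfl
    exact blockOf_iso _ _ _
  · rintro _ rfl e he
    exact mem_edgeSet_blockOf_P4.1 he
  · intro e he
    exact ⟨_, ⟨rfl, mem_edgeSet_blockOf_P4.2 he⟩, fun B hB => hB.1⟩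

lemma PathDec.three_dvd {E : Finset (Sym2 U)} (h : PathDec (E : Set (Sym2 U))) : 3 ∣ E.card := by
  obtain ⟨𝓟, h1, h2, h3⟩ := h
  exact dvd_card_of_partition E 𝓟 (fun B => B.edgeSet) h3 h2 fun B hB _ => ncard_edgeSet_P4 (h1 B hB)

/-- A choice of a copy of `P₄` in every block of a design is pairwise edge-disjoint. -/
lemma IsDesign.pathDec_iUnion {K : GraphIn U} {𝓑 : Set (GraphIn U)} (h : IsDesign K C4 𝓑)
    (f : 𝓑 → GraphIn U) (hf : ∀ B, f B ≤ B) (hf' : ∀ B, Nonempty ((f B).coe ≃g P4)) :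
    PathDec (⋃ B, (f B).edgeSet) := by
  refine ⟨Set.range f, ?_, ?_, ?_⟩
  · rintro _ ⟨B, rfl⟩
    exact hf' B
  · rintro _ ⟨B, rfl⟩
    exact Set.subset_iUnion (fun B => (f B).edgeSet) B
  · intro e he
    obtain ⟨B, hB⟩ := Set.mem_iUnion.1 he
    refine ⟨f B, ⟨⟨B, rfl⟩, hB⟩, ?_⟩
    rintro _ ⟨⟨C, rfl⟩, hC⟩
    have hsub := fun D => SimpleGraph.Subgraph.edgeSet_mono (hf D)
    have : C = B := Subtype.ext <| (h.partition e
      (SimpleGraph.Subgraph.edgeSet_mono (h.le B B.2) (hsub B hB))).unique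
        ⟨C.2, hsub C hC⟩ ⟨B.2, hsub B hB⟩
    rw [this]

/-- The chosen paths, completed by any decomposition of the unused edges, are the target design, and
`f` is the link. All constructions thus reduce to decomposing the unused edges. -/
lemma IsDesign.exists_link {X Y : Finset U} {𝓑 : Set (GraphIn U)}
    (h : IsDesign (completeOn X) C4 𝓑) (hXY : X ⊆ Y) (f : 𝓑 → GraphIn U) (hf : ∀ B, f B ≤ B)
    (hf' : ∀ B, Nonempty ((f B).coe ≃g P4))
    (hrest : PathDec ((completeOn Y).edgeSet \ ⋃ B, (f B).edgeSet)) :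
    ∃ 𝓑', IsDesign (completeOn Y) P4 𝓑' ∧ CanDownLink 𝓑 𝓑' := by
  obtain ⟨𝓟, h1, h2, h3⟩ := hrest
  have hXYe : (completeOn X).edgeSet ⊆ (completeOn Y).edgeSet := by
    intro e
    induction e with | _ x y =>
    rw [mem_edgeSet_completeOn, mem_edgeSet_completeOn]
    rintro ⟨hx, hy, hxy⟩
    exact ⟨hXY hx, hXY hy, hxy⟩
  have hsub : ∀ B, (f B).edgeSet ⊆ (completeOn X).edgeSet := fun B =>
    SimpleGraph.Subgraph.edgeSet_mono ((hf B).trans (h.le B B.2))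
  have hiso : ∀ B ∈ Set.range f ∪ 𝓟, Nonempty (B.coe ≃g P4) := by
    rintro B (⟨C, rfl⟩ | hB)
    exacts [hf' C, h1 B hB]
  refine ⟨Set.range f ∪ 𝓟, ⟨?_, hiso, ?_⟩, fun B => ⟨f B, Or.inl ⟨B, rfl⟩⟩, hf⟩
  · intro B hB
    refine le_of_edgeSet_subset (exists_adj_P4 (hiso B hB)) ?_
    rcases hB with ⟨C, rfl⟩ | hB
    exacts [(hsub C).trans hXYe, (h2 B hB).trans Set.sdiff_subset]
  · intro e he
    by_cases heF : e ∈ ⋃ B, (f B).edgeSet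
    · obtain ⟨B, hB⟩ := Set.mem_iUnion.1 heF
      refine ⟨f B, ⟨Or.inl ⟨B, rfl⟩, hB⟩, ?_⟩
      rintro _ ⟨⟨C, rfl⟩ | hC, heC⟩
      · have hsub' := fun D => SimpleGraph.Subgraph.edgeSet_mono (hf D)
        have : C = B := Subtype.ext <| (h.partition e (hsub B hB)).unique
          ⟨C.2, hsub' C heC⟩ ⟨B.2, hsub' B hB⟩
        rw [this]
      · exact absurd heF (h2 _ hC heC).2
    · obtain ⟨B, hB, hu⟩ := h3 e ⟨he, heF⟩
      refine ⟨B, ⟨Or.inr hB.1, hB.2⟩, ?_⟩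
      rintro C ⟨⟨D, rfl⟩ | hC, heC⟩
      · exact absurd (Set.mem_iUnion.2 ⟨D, heC⟩) heF
      · exact hu C ⟨hC, heC⟩

end Designs

/-! ### Explicit decompositions of small graphs -/

section SmallDecompositions

variable {U : Type*} [DecidableEq U]

open Function

/-- The pair `q` with its larger entry first. -/
def sortPair (q : ℕ × ℕ) : ℕ × ℕ := if q.1 < q.2 then (q.2, q.1) else q

/-- The vertices of the path traced out by `p`. -/
def pathVerts {α : Type*} (p : α × α × α × α) : List α := [p.1, p.2.1, p.2.2.1, p.2.2.2]

/-- The edges of the path traced out by `p`. -/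
def pathEdges {α : Type*} (p : α × α × α × α) : List (α × α) :=
  [(p.1, p.2.1), (p.2.1, p.2.2.1), (p.2.2.1, p.2.2.2)]

lemma sym2_sortPair {α : Type*} (φ : ℕ → α) (q : ℕ × ℕ) :
    s(φ (sortPair q).1, φ (sortPair q).2) = s(φ q.1, φ q.2) := by
  unfold sortPair
  split_ifs
  exacts [Sym2.eq_swap, rfl]

lemma sortPair_swap (i j : ℕ) : sortPair (i, j) = sortPair (j, i) := by
  unfold sortPair
  rcases lt_trichotomy i j with h | rfl | h
  · simp [h, h.not_gt]
  · simp
  · simp [h, h.not_gt]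

lemma sortPair_eq {α : Type*} {φ : ℕ → α} {s : Set ℕ} (hφ : Set.InjOn φ s) {q r : ℕ × ℕ}
    (hq : q.1 ∈ s ∧ q.2 ∈ s) (hr : r.1 ∈ s ∧ r.2 ∈ s)
    (h : s(φ q.1, φ q.2) = s(φ r.1, φ r.2)) : sortPair q = sortPair r := by
  rcases Sym2.eq_iff.1 h with ⟨h, h'⟩ | ⟨h, h'⟩
  · rw [Prod.ext (hφ hq.1 hr.1 h) (hφ hq.2 hr.2 h')]
  · rw [← Prod.mk.eta (p := q), hφ hq.1 hr.2 h, hφ hq.2 hr.1 h', sortPair_swap]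

/-- An injective labelling carries edge-disjoint paths on numbers to edge-disjoint paths. Sorting
each pair makes equality of unordered edges decidable on lists of numbers. -/
lemma pathDec_of_injOn {φ : ℕ → U} {s : Set ℕ} (hφ : Set.InjOn φ s) (l : List (ℕ × ℕ × ℕ × ℕ))
    (h1 : ∀ p ∈ l, (pathVerts p).Nodup ∧ ∀ i ∈ pathVerts p, i ∈ s)
    (h2 : ((l.flatMap pathEdges).map sortPair).Nodup) :
    PathDec (((l.flatMap pathEdges).map fun q => s(φ q.1, φ q.2)).toFinset : Set (Sym2 U)) := by
  induction l with
  | nil => simpa using pathDec_empty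
  | cons p l ih =>
    rw [List.flatMap_cons, List.map_append, List.nodup_append'] at h2
    have hs : ∀ p' ∈ p :: l, ∀ q ∈ pathEdges p', q.1 ∈ s ∧ q.2 ∈ s := by
      intro p' hp' q hq
      have := (h1 p' hp').2
      simp only [pathVerts, pathEdges, List.mem_cons, List.not_mem_nil, or_false] at this hq
      rcases hq with rfl | rfl | rfl <;> simp [this]
    have hp : PathDec (((pathEdges p).map fun q => s(φ q.1, φ q.2)).toFinset : Set (Sym2 U)) := by
      have h := h1 p (by simp)
      have hn : ((pathVerts p).map φ).Nodup :=
        h.1.map_on fun i hi j hj hij => hφ (h.2 i hi) (h.2 j hj) hij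
      simpa [pathEdges] using pathDec_path hn
    have hl := ih (fun q hq => h1 q (by simp [hq])) h2.2.1
    rw [List.flatMap_cons, List.map_append, List.toFinset_append, Finset.coe_union]
    refine hp.union hl ?_
    rw [Finset.disjoint_coe, List.disjoint_toFinset_iff_disjoint]
    intro e he he'
    obtain ⟨q, hq, rfl⟩ := List.mem_map.1 he
    obtain ⟨r, hr, hqr⟩ := List.mem_map.1 he'
    obtain ⟨p', hp', hr'⟩ := List.mem_flatMap.1 hr
    refine h2.2.2 (List.mem_map_of_mem hq) ?_
    rw [← sortPair_eq hφ (hs p' (by simp [hp']) r hr') (hs p (by simp) q hq) hqr]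
    exact List.mem_map_of_mem hr

/-- The graph with vertices `L` and edges `E` (given by indices) is decomposed by the paths `l`. -/
lemma pathDec_of_paths {L : List U} (hL : L.Nodup) (d : U) (k : ℕ) (hk : L.length = k)
    (l : List (ℕ × ℕ × ℕ × ℕ)) (E : List (ℕ × ℕ))
    (h1 : ∀ p ∈ l, (pathVerts p).Nodup ∧ ∀ i ∈ pathVerts p, i < k)
    (h2 : (E.map sortPair).Nodup)
    (h3 : ((l.flatMap pathEdges).map sortPair).isPerm (E.map sortPair) = true) :
    PathDec ((E.map fun q => s(L.getD q.1 d, L.getD q.2 d)).toFinset : Set (Sym2 U)) := by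
  -- The default `d` is never read, since all indices of paths lie below the length of `L`.
  have hφ : Set.InjOn (fun i => L.getD i d) (Set.Iio k) := by
    intro i hi j hj hij
    subst hk
    simp only [Set.mem_Iio] at hi hj
    simp only [List.getD_eq_getElem _ _ hi, List.getD_eq_getElem _ _ hj] at hij
    exact (hL.getElem_inj_iff).1 hij
  rw [List.isPerm_iff] at h3
  have h4 := h3.symm.map fun q => s(L.getD q.1 d, L.getD q.2 d)
  have h5 := sym2_sortPair fun i => L.getD i d
  simp only [List.map_map, comp_def, h5] at h4
  rw [List.toFinset_eq_of_perm _ _ h4]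
  exact pathDec_of_injOn hφ l h1 (h3.nodup_iff.2 h2)

/-- Here and below, indices 0 and 1 stand for `a` and `b`, and the further indices follow the list
in `h`. The two paths are `a l b m` and `a m c l`. -/
lemma pathDec_leaves {a b c l m : U} (h : [a, b, c, l, m].Nodup) :
    PathDec (({s(c, l), s(c, m), s(l, a), s(l, b), s(m, a), s(m, b)} : Finset (Sym2 U)) :
      Set (Sym2 U)) := by
  have key := pathDec_of_paths h a 5 rfl
    [(0, 3, 1, 4), (0, 4, 2, 3)]
    [(2, 3), (2, 4), (3, 0), (3, 1), (4, 0), (4, 1)] (by decide) (by decide) (by decide)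
  simp only [List.map_cons, List.map_nil,
    List.toFinset_cons, List.toFinset_nil, insert_empty_eq] at key
  exact key

/-- The terminal case of removing two leaves, where only the triangle `abc` would remain: the whole
is a complete graph on five vertices minus `lm`. -/
lemma pathDec_leaves_last {a b c l m : U} (h : [a, b, c, l, m].Nodup) :
    PathDec (({s(c, l), s(c, m), s(l, a), s(l, b), s(m, a), s(m, b)} ∪
      {s(a, b), s(c, a), s(c, b)} : Finset (Sym2 U)) : Set (Sym2 U)) := by
  have key := pathDec_of_paths h a 5 rfl
    [(0, 1, 2, 3), (0, 2, 4, 1), (1, 3, 0, 4)]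
    ([(2, 3), (2, 4), (3, 0), (3, 1), (4, 0), (4, 1)] ++ [(0, 1), (2, 0), (2, 1)])
    (by decide) (by decide) (by decide)
  simp only [List.map_append, List.map_cons, List.map_nil, List.toFinset_append,
    List.toFinset_cons, List.toFinset_nil, insert_empty_eq] at key
  exact key

lemma pathDec_triangle {a b x y z : U} (h : [a, b, x, y, z].Nodup) :
    PathDec (({s(x, y), s(x, z), s(y, z), s(x, a), s(x, b), s(y, a), s(y, b), s(z, a), s(z, b)} :
      Finset (Sym2 U)) : Set (Sym2 U)) := by
  have key := pathDec_of_paths h a 5 rfl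
    [(0, 2, 1, 3), (0, 3, 4, 1), (0, 4, 2, 3)]
    [(2, 3), (2, 4), (3, 4), (2, 0), (2, 1), (3, 0), (3, 1), (4, 0), (4, 1)]
    (by decide) (by decide) (by decide)
  simp only [List.map_cons, List.map_nil,
    List.toFinset_cons, List.toFinset_nil, insert_empty_eq] at key
  exact key

lemma pathDec_triangle_last {a b x y z w : U} (h : [a, b, x, y, z, w].Nodup) :
    PathDec (({s(x, y), s(x, z), s(y, z), s(x, a), s(x, b), s(y, a), s(y, b), s(z, a), s(z, b)} ∪
      {s(a, b), s(w, a), s(w, b)} : Finset (Sym2 U)) : Set (Sym2 U)) := by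
  have key := pathDec_of_paths h a 6 rfl
    [(0, 1, 2, 3), (0, 2, 4, 1), (0, 3, 1, 5), (3, 4, 0, 5)]
    ([(2, 3), (2, 4), (3, 4), (2, 0), (2, 1), (3, 0), (3, 1), (4, 0), (4, 1)] ++
      [(0, 1), (5, 0), (5, 1)]) (by decide) (by decide) (by decide)
  simp only [List.map_append, List.map_cons, List.map_nil, List.toFinset_append,
    List.toFinset_cons, List.toFinset_nil, insert_empty_eq] at key
  exact key

/-- The edges at `x` and `y` in the join of `{a, b}` with the edge `xy`, or with the vertex `x` in
case `x = y`. -/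
def compEdges (a b x y : U) : Finset (Sym2 U) :=
  if x = y then {s(x, a), s(x, b)} else {s(x, y), s(x, a), s(x, b), s(y, a), s(y, b)}

lemma mem_compEdges {a b x y : U} {e : Sym2 U} : e ∈ compEdges a b x y ↔
    e = s(x, a) ∨ e = s(x, b) ∨ e = s(y, a) ∨ e = s(y, b) ∨ (x ≠ y ∧ e = s(x, y)) := by
  unfold compEdges
  split_ifs with h
  · subst h; simp; tauto
  · simp; tauto

/-- This is the complete graph on four vertices, two paths. -/
lemma pathDec_edge_last {a b x y : U} (h : [a, b, x, y].Nodup) :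
    PathDec ((compEdges a b x y ∪ {s(a, b)} : Finset (Sym2 U)) : Set (Sym2 U)) := by
  have hxy : x ≠ y := by simp at h; tauto
  have key := pathDec_of_paths h a 4 rfl
    [(0, 1, 2, 3), (1, 3, 0, 2)]
    ([(2, 3), (2, 0), (2, 1), (3, 0), (3, 1)] ++ [(0, 1)]) (by decide) (by decide) (by decide)
  simp only [List.map_append, List.map_cons, List.map_nil, List.toFinset_append,
    List.toFinset_cons, List.toFinset_nil, insert_empty_eq] at key
  simp only [compEdges, hxy, if_false]
  exact key

lemma pathDec_isolated_last {a b x y z w : U} (h : [a, b, x, y, z, w].Nodup) :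
    PathDec ((compEdges a b x x ∪ (compEdges a b y y ∪ compEdges a b z z ∪ compEdges a b w w) ∪
      {s(a, b)} : Finset (Sym2 U)) : Set (Sym2 U)) := by
  have key := pathDec_of_paths h a 6 rfl
    [(2, 0, 1, 3), (1, 4, 0, 3), (0, 5, 1, 2)]
    ([(2, 0), (2, 1)] ++ ([(3, 0), (3, 1)] ++ [(4, 0), (4, 1)] ++ [(5, 0), (5, 1)]) ++ [(0, 1)])
    (by decide) (by decide) (by decide)
  simp only [List.map_append, List.map_cons, List.map_nil, List.toFinset_append,
    List.toFinset_cons, List.toFinset_nil, insert_empty_eq] at key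
  simp only [compEdges, if_true]
  exact key

/-- A component contributes 2 or 5 edges, both 2 mod 3, so three of them always give a multiple of
3. The eight patterns of vertices and edges are treated one by one. -/
lemma pathDec_three_comps {a b x₁ y₁ x₂ y₂ x₃ y₃ : U} (hab : a ≠ b)
    (h₁ : x₁ ∉ [a, b] ∧ y₁ ∉ [a, b]) (h₂ : x₂ ∉ [a, b, x₁, y₁] ∧ y₂ ∉ [a, b, x₁, y₁])
    (h₃ : x₃ ∉ [a, b, x₁, y₁, x₂, y₂] ∧ y₃ ∉ [a, b, x₁, y₁, x₂, y₂]) :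
    PathDec ((compEdges a b x₁ y₁ ∪ compEdges a b x₂ y₂ ∪ compEdges a b x₃ y₃ : Finset (Sym2 U)) :
      Set (Sym2 U)) := by
  simp only [List.mem_cons, List.not_mem_nil, or_false, not_or] at h₁ h₂ h₃
  by_cases e₁ : x₁ = y₁ <;> by_cases e₂ : x₂ = y₂ <;> by_cases e₃ : x₃ = y₃
  · subst e₁ e₂ e₃
    have h : [a, b, x₁, x₂, x₃].Nodup := by
      simp; grind
    have key := pathDec_of_paths h a 5 rfl
      [(0, 2, 1, 3), (1, 4, 0, 3)]
      ([(2, 0), (2, 1)] ++ [(3, 0), (3, 1)] ++ [(4, 0), (4, 1)]) (by decide) (by decide) (by decide)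
    simp only [List.map_append, List.map_cons, List.map_nil, List.toFinset_append,
    List.toFinset_cons, List.toFinset_nil, insert_empty_eq] at key
    simp only [compEdges, if_true]
    exact key
  · subst e₁ e₂
    have h : [a, b, x₁, x₂, x₃, y₃].Nodup := by
      simp; grind
    have key := pathDec_of_paths h a 6 rfl
      [(0, 2, 1, 3), (3, 0, 4, 5), (0, 5, 1, 4)]
      ([(2, 0), (2, 1)] ++ [(3, 0), (3, 1)] ++ [(4, 5), (4, 0), (4, 1), (5, 0), (5, 1)])
      (by decide) (by decide) (by decide)
    simp only [List.map_append, List.map_cons, List.map_nil, List.toFinset_append,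
    List.toFinset_cons, List.toFinset_nil, insert_empty_eq] at key
    simp only [compEdges, if_true, e₃, if_false]
    exact key
  · subst e₁ e₃
    have h : [a, b, x₁, x₂, y₂, x₃].Nodup := by
      simp; grind
    have key := pathDec_of_paths h a 6 rfl
      [(0, 2, 1, 3), (0, 3, 4, 1), (1, 5, 0, 4)]
      ([(2, 0), (2, 1)] ++ [(3, 4), (3, 0), (3, 1), (4, 0), (4, 1)] ++ [(5, 0), (5, 1)])
      (by decide) (by decide) (by decide)
    simp only [List.map_append, List.map_cons, List.map_nil, List.toFinset_append,
    List.toFinset_cons, List.toFinset_nil, insert_empty_eq] at key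
    simp only [compEdges, if_true, e₂, if_false]
    exact key
  · subst e₁
    have h : [a, b, x₁, x₂, y₂, x₃, y₃].Nodup := by
      simp; grind
    have key := pathDec_of_paths h a 7 rfl
      [(0, 2, 1, 3), (0, 3, 4, 1), (4, 0, 5, 6), (0, 6, 1, 5)]
      ([(2, 0), (2, 1)] ++ [(3, 4), (3, 0), (3, 1), (4, 0), (4, 1)] ++
          [(5, 6), (5, 0), (5, 1), (6, 0), (6, 1)]) (by decide) (by decide) (by decide)
    simp only [List.map_append, List.map_cons, List.map_nil, List.toFinset_append,
    List.toFinset_cons, List.toFinset_nil, insert_empty_eq] at key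
    simp only [compEdges, if_true, e₂, if_false, e₃, if_false]
    exact key
  · subst e₂ e₃
    have h : [a, b, x₁, y₁, x₂, x₃].Nodup := by
      simp; grind
    have key := pathDec_of_paths h a 6 rfl
      [(0, 2, 1, 3), (2, 3, 0, 4), (0, 5, 1, 4)]
      ([(2, 3), (2, 0), (2, 1), (3, 0), (3, 1)] ++ [(4, 0), (4, 1)] ++ [(5, 0), (5, 1)])
      (by decide) (by decide) (by decide)
    simp only [List.map_append, List.map_cons, List.map_nil, List.toFinset_append,
    List.toFinset_cons, List.toFinset_nil, insert_empty_eq] at key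
    simp only [compEdges, if_true, e₁, if_false]
    exact key
  · subst e₂
    have h : [a, b, x₁, y₁, x₂, x₃, y₃].Nodup := by
      simp; grind
    have key := pathDec_of_paths h a 7 rfl
      [(0, 2, 1, 3), (2, 3, 0, 4), (1, 5, 0, 6), (4, 1, 6, 5)]
      ([(2, 3), (2, 0), (2, 1), (3, 0), (3, 1)] ++ [(4, 0), (4, 1)] ++
          [(5, 6), (5, 0), (5, 1), (6, 0), (6, 1)]) (by decide) (by decide) (by decide)
    simp only [List.map_append, List.map_cons, List.map_nil, List.toFinset_append,
    List.toFinset_cons, List.toFinset_nil, insert_empty_eq] at key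
    simp only [compEdges, if_true, e₁, if_false, e₃, if_false]
    exact key
  · subst e₃
    have h : [a, b, x₁, y₁, x₂, y₂, x₃].Nodup := by
      simp; grind
    have key := pathDec_of_paths h a 7 rfl
      [(0, 2, 1, 3), (2, 3, 0, 4), (0, 5, 4, 1), (0, 6, 1, 5)]
      ([(2, 3), (2, 0), (2, 1), (3, 0), (3, 1)] ++
          [(4, 5), (4, 0), (4, 1), (5, 0), (5, 1)] ++ [(6, 0), (6, 1)])
          (by decide) (by decide) (by decide)
    simp only [List.map_append, List.map_cons, List.map_nil, List.toFinset_append,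
    List.toFinset_cons, List.toFinset_nil, insert_empty_eq] at key
    simp only [compEdges, if_true, e₁, if_false, e₂, if_false]
    exact key
  · have h : [a, b, x₁, y₁, x₂, y₂, x₃, y₃].Nodup := by
      simp; grind
    have key := pathDec_of_paths h a 8 rfl
      [(0, 2, 1, 3), (2, 3, 0, 4), (0, 5, 4, 1), (1, 6, 0, 7), (5, 1, 7, 6)]
      ([(2, 3), (2, 0), (2, 1), (3, 0), (3, 1)] ++
          [(4, 5), (4, 0), (4, 1), (5, 0), (5, 1)] ++
          [(6, 7), (6, 0), (6, 1), (7, 0), (7, 1)]) (by decide) (by decide) (by decide)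
    simp only [List.map_append, List.map_cons, List.map_nil, List.toFinset_append,
    List.toFinset_cons, List.toFinset_nil, insert_empty_eq] at key
    simp only [compEdges, e₁, e₂, e₃, if_false]
    exact key

end SmallDecompositions

/-! ### Graphs with two dominating vertices, and their components -/

section Join

variable {U : Type*} [DecidableEq U]

open Function

/-- The edge set `E` contains `ab`, and each other vertex is isolated or joined to `a` and `b`. -/
structure IsJoin (a b : U) (E : Finset (Sym2 U)) : Prop where
  ne : a ≠ b
  mem : s(a, b) ∈ E
  loopless : ∀ x, s(x, x) ∉ E
  left : ∀ x y, s(x, y) ∈ E → x ≠ a → x ≠ b → s(x, a) ∈ E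
  right : ∀ x y, s(x, y) ∈ E → x ≠ a → x ≠ b → s(x, b) ∈ E

namespace IsJoin

variable {a b : U} {E : Finset (Sym2 U)}

lemma ne_of_mem (h : IsJoin a b E) {x y : U} (hxy : s(x, y) ∈ E) : x ≠ y := by
  rintro rfl
  exact h.loopless x hxy

/-- A vertex may lose its edge to `a` or `b` only by becoming isolated; this is exactly what `hP`
demands. -/
lemma sdiff (h : IsJoin a b E) {P : Finset (Sym2 U)} (hab : s(a, b) ∉ P)
    (hP : ∀ x, x ≠ a → x ≠ b → s(x, a) ∈ P ∨ s(x, b) ∈ P → ∀ y, s(x, y) ∈ E → s(x, y) ∈ P) :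
    IsJoin a b (E \ P) where
  ne := h.ne
  mem := Finset.mem_sdiff.2 ⟨h.mem, hab⟩
  loopless x hx := h.loopless x (Finset.mem_sdiff.1 hx).1
  left x y hxy ha hb := by
    rw [Finset.mem_sdiff] at hxy ⊢
    exact ⟨h.left x y hxy.1 ha hb, fun hx => hxy.2 (hP x ha hb (Or.inl hx) y hxy.1)⟩
  right x y hxy ha hb := by
    rw [Finset.mem_sdiff] at hxy ⊢
    exact ⟨h.right x y hxy.1 ha hb, fun hx => hxy.2 (hP x ha hb (Or.inr hx) y hxy.1)⟩

/-- If `E` has a further edge then some vertex other than `a` and `b` is not isolated. -/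
lemma exists_vertex (h : IsJoin a b E) (hE : 1 < E.card) : ∃ x, x ≠ a ∧ x ≠ b ∧ s(x, a) ∈ E := by
  obtain ⟨e, he, hne⟩ := Finset.exists_mem_ne hE s(a, b)
  induction e with | _ x y =>
  have hxy := h.ne_of_mem he
  by_cases hx : x ≠ a ∧ x ≠ b
  · exact ⟨x, hx.1, hx.2, h.left x y he hx.1 hx.2⟩
  · have hy : y ≠ a ∧ y ≠ b := by
      rw [ne_eq, Sym2.eq_iff] at hne
      grind
    rw [Sym2.eq_swap] at he
    exact ⟨y, hy.1, hy.2, h.left y x he hy.1 hy.2⟩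

lemma triangle_subset (h : IsJoin a b E) {x : U} (hxa : x ≠ a) (hxb : x ≠ b) (hx : s(x, a) ∈ E) :
    ({s(a, b), s(x, a), s(x, b)} : Finset (Sym2 U)) ⊆ E ∧
      ({s(a, b), s(x, a), s(x, b)} : Finset (Sym2 U)).card = 3 := by
  constructor
  · have := h.right x a hx hxa hxb
    intro e
    simp only [Finset.mem_insert, Finset.mem_singleton]
    rintro (rfl | rfl | rfl)
    exacts [h.mem, hx, this]
  · have := h.ne
    rw [Finset.card_eq_three]
    exact ⟨_, _, _, by simp; grind, by simp; grind, by simp; grind, rfl⟩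

lemma eq_triangle (h : IsJoin a b E) (hE : E.card = 3) {x : U} (hxa : x ≠ a) (hxb : x ≠ b)
    (hx : s(x, a) ∈ E) : E = {s(a, b), s(x, a), s(x, b)} := by
  obtain ⟨h1, h2⟩ := h.triangle_subset hxa hxb hx
  exact (Finset.eq_of_subset_of_card_le h1 (by rw [h2, hE])).symm

/-- Any two adjacent vertices other than `a` and `b` have no further neighbors besides those. -/
def IsMatch (a b : U) (E : Finset (Sym2 U)) : Prop :=
  ∀ x y z, x ≠ a → x ≠ b → y ≠ a → y ≠ b → z ≠ a → z ≠ b → s(x, y) ∈ E → s(x, z) ∈ E → y = z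

/-- `x` and `y` form a connected component of the graph without the vertices `a` and `b`. -/
structure IsComp (a b : U) (E : Finset (Sym2 U)) (x y : U) : Prop where
  xa : x ≠ a
  xb : x ≠ b
  ya : y ≠ a
  yb : y ≠ b
  sub : compEdges a b x y ⊆ E
  xmax : ∀ z, s(x, z) ∈ E → s(x, z) ∈ compEdges a b x y
  ymax : ∀ z, s(y, z) ∈ E → s(y, z) ∈ compEdges a b x y

lemma mem_compEdges_left {x y : U} : s(x, a) ∈ compEdges a b x y := by simp [mem_compEdges]

lemma mem_compEdges_right {x y : U} : s(y, a) ∈ compEdges a b x y := by simp [mem_compEdges]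

lemma mem_compEdges_iff {x y z : U} (hxa : x ≠ a) (hxb : x ≠ b) (hya : y ≠ a) (hyb : y ≠ b)
    (hza : z ≠ a) (hzb : z ≠ b) : s(z, a) ∈ compEdges a b x y ∨ s(z, b) ∈ compEdges a b x y ↔
      z = x ∨ z = y := by
  simp only [mem_compEdges, Sym2.eq_iff]
  grind

lemma isComp_edge (h : IsJoin a b E) (hm : IsMatch a b E) {x y : U} (hxa : x ≠ a) (hxb : x ≠ b)
    (hya : y ≠ a) (hyb : y ≠ b) (hxy : s(x, y) ∈ E) : IsComp a b E x y where
  xa := hxa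
  xb := hxb
  ya := hya
  yb := hyb
  sub := by
    have hyx : s(y, x) ∈ E := by rwa [Sym2.eq_swap]
    have h1 := h.left x y hxy hxa hxb
    have h2 := h.right x y hxy hxa hxb
    have h3 := h.left y x hyx hya hyb
    have h4 := h.right y x hyx hya hyb
    intro e
    rw [mem_compEdges]
    rintro (rfl | rfl | rfl | rfl | ⟨-, rfl⟩) <;> assumption
  xmax z hz := by
    rw [mem_compEdges]
    by_cases hza : z = a
    · simp [hza]
    by_cases hzb : z = b
    · simp [hzb]
    have := hm x y z hxa hxb hya hyb hza hzb hxy hz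
    have := h.ne_of_mem hxy
    grind
  ymax z hz := by
    have hyx : s(y, x) ∈ E := by rwa [Sym2.eq_swap]
    rw [mem_compEdges]
    by_cases hza : z = a
    · simp [hza]
    by_cases hzb : z = b
    · simp [hzb]
    have := hm y x z hya hyb hxa hxb hza hzb hyx hz
    have := h.ne_of_mem hxy
    have := Sym2.eq_swap (a := y) (b := x)
    grind

lemma exists_comp (h : IsJoin a b E) (hm : IsMatch a b E) (hE : 1 < E.card) :
    ∃ x y, IsComp a b E x y := by
  obtain ⟨x, hxa, hxb, hx⟩ := h.exists_vertex hE
  by_cases hy : ∃ y, y ≠ a ∧ y ≠ b ∧ s(x, y) ∈ E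
  · obtain ⟨y, hya, hyb, hxy⟩ := hy
    exact ⟨x, y, h.isComp_edge hm hxa hxb hya hyb hxy⟩
  · have hb := h.right x a hx hxa hxb
    have hmax : ∀ z, s(x, z) ∈ E → s(x, z) ∈ compEdges a b x x := by
      intro z hz
      rw [mem_compEdges]
      have : z = a ∨ z = b := by
        by_contra! hc
        exact hy ⟨z, hc.1, hc.2, hz⟩
      rcases this with rfl | rfl <;> simp
    refine ⟨x, x, hxa, hxb, hxa, hxb, ?_, hmax, hmax⟩
    intro e
    rw [mem_compEdges]
    rintro (rfl | rfl | rfl | rfl | ⟨h, -⟩)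
    exacts [hx, hb, hx, hb, absurd rfl h]

lemma IsMatch.mono {F : Finset (Sym2 U)} (hm : IsMatch a b E) (hF : F ⊆ E) : IsMatch a b F :=
  fun x y z h1 h2 h3 h4 h5 h6 h7 h8 => hm x y z h1 h2 h3 h4 h5 h6 (hF h7) (hF h8)

namespace IsComp

variable {x y u v : U}

lemma notMem (hc : IsComp a b E x y) : s(a, b) ∉ compEdges a b x y := by
  obtain ⟨h1, h2, h3, h4, -⟩ := hc
  simp only [mem_compEdges, Sym2.eq_iff]
  grind

lemma max (hc : IsComp a b E x y) {z : U} (hza : z ≠ a) (hzb : z ≠ b)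
    (h : s(z, a) ∈ compEdges a b x y ∨ s(z, b) ∈ compEdges a b x y) (w : U) (hw : s(z, w) ∈ E) :
    s(z, w) ∈ compEdges a b x y := by
  rw [mem_compEdges_iff hc.xa hc.xb hc.ya hc.yb hza hzb] at h
  rcases h with rfl | rfl
  exacts [hc.xmax w hw, hc.ymax w hw]

lemma isJoin (hc : IsComp a b E x y) (h : IsJoin a b E) : IsJoin a b (E \ compEdges a b x y) :=
  h.sdiff hc.notMem fun _ hza hzb => hc.max hza hzb

lemma card_compEdges (hc : IsComp a b E x y) (h : IsJoin a b E) :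
    (compEdges a b x y).card = if x = y then 2 else 5 := by
  obtain ⟨h1, h2, h3, h4, -⟩ := hc
  have := h.ne
  unfold compEdges
  split_ifs with hxy
  · rw [Finset.card_pair]
    simp; grind
  · rw [Finset.card_insert_of_notMem, Finset.card_insert_of_notMem, Finset.card_insert_of_notMem,
      Finset.card_pair]
    all_goals simp; grind

lemma card_sdiff (hc : IsComp a b E x y) (h : IsJoin a b E) :
    (E \ compEdges a b x y).card + (if x = y then 2 else 5) = E.card := by
  rw [← hc.card_compEdges h, Finset.card_sdiff_add_card_eq_card hc.sub]

/-- Removing a component takes away all edges at its vertices and, away from `a` and `b`, no edge at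
any other vertex. -/
lemma of_sdiff (hc : IsComp a b E x y) (hd : IsComp a b (E \ compEdges a b x y) u v) :
    IsComp a b E u v ∧ u ∉ [x, y] ∧ v ∉ [x, y] := by
  have key : ∀ z, z ≠ a → z ≠ b → s(z, a) ∈ E \ compEdges a b x y → z ≠ x ∧ z ≠ y := by
    intro z hza hzb hz
    rw [Finset.mem_sdiff] at hz
    rw [← not_or]
    refine fun h => hz.2 ?_
    rcases h with rfl | rfl
    exacts [mem_compEdges_left, mem_compEdges_right]
  have hu := key u hd.xa hd.xb (hd.sub mem_compEdges_left)
  have hv := key v hd.ya hd.yb (hd.sub mem_compEdges_right)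
  have hmem : ∀ z w, z ≠ a → z ≠ b → z ≠ x ∧ z ≠ y → s(z, w) ∉ compEdges a b x y := by
    intro z w hza hzb hz
    simp only [mem_compEdges, Sym2.eq_iff]
    grind
  refine ⟨⟨hd.xa, hd.xb, hd.ya, hd.yb, hd.sub.trans Finset.sdiff_subset, ?_, ?_⟩, ?_, ?_⟩
  · exact fun z hz => hd.xmax z (Finset.mem_sdiff.2 ⟨hz, hmem u z hd.xa hd.xb hu⟩)
  · exact fun z hz => hd.ymax z (Finset.mem_sdiff.2 ⟨hz, hmem v z hd.ya hd.yb hv⟩)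
  · simpa using hu
  · simpa using hv

end IsComp

end IsJoin

end Join

/-! ### Decomposing every such graph other than the triangle -/

section JoinDecomposition

variable {U : Type*} [DecidableEq U]

open Function

namespace IsJoin

variable {a b : U} {E : Finset (Sym2 U)}

/-- Removing a decomposable set of edges leaves a triangle or reduces to a smaller join. -/
lemma pathDec_or_card_eq {P : Finset (Sym2 U)} (h3 : 3 ∣ E.card)
    (ih : ∀ F : Finset (Sym2 U), F.card < E.card → IsJoin a b F → 3 ∣ F.card → 3 < F.card →
      PathDec (F : Set (Sym2 U)))
    (hP : PathDec (P : Set (Sym2 U))) (hne : P.Nonempty) (hsub : P ⊆ E)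
    (hJ : IsJoin a b (E \ P)) :
    (E \ P).card = 3 ∨ PathDec (E : Set (Sym2 U)) := by
  have hc := Finset.card_sdiff_add_card_eq_card hsub
  have hpos := hne.card_pos
  have hpos' := Finset.card_pos.2 ⟨_, hJ.mem⟩
  -- The remainder contains `ab` and has a multiple of 3 edges, so it has either exactly 3 or more.
  have h3P := hP.three_dvd
  rcases eq_or_ne (E \ P).card 3 with h | h
  · exact Or.inl h
  · refine Or.inr (hP.of_diff (by exact_mod_cast hsub) ?_)
    have := ih (E \ P) (by omega) hJ (by omega) (by omega)
    rwa [Finset.coe_sdiff] at this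

lemma pathDec_of_sdiff_eq {P Q : Finset (Sym2 U)} (hsub : P ⊆ E) (hQ : E \ P = Q)
    (h : PathDec ((P ∪ Q : Finset (Sym2 U)) : Set (Sym2 U))) : PathDec (E : Set (Sym2 U)) := by
  rwa [← hQ, Finset.union_sdiff_of_subset hsub] at h

/-- With `k` components the edge count is `2k + 1` mod 3, so `k ≡ 1` mod 3: there is one component,
or at least four and three can be removed. -/
lemma pathDec_of_isMatch (h : IsJoin a b E) (hm : IsMatch a b E) (h3 : 3 ∣ E.card)
    (hE : 3 < E.card)
    (ih : ∀ F : Finset (Sym2 U), F.card < E.card → IsJoin a b F → 3 ∣ F.card → 3 < F.card →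
      PathDec (F : Set (Sym2 U))) : PathDec (E : Set (Sym2 U)) := by
  -- The component to be kept is an edge whenever one exists, so if it is a single vertex then all
  -- components are.
  obtain ⟨x₁, y₁, c₁, hiso⟩ : ∃ x y, IsComp a b E x y ∧ (x = y → ∀ u v, u ≠ a → u ≠ b → v ≠ a →
      v ≠ b → s(u, v) ∉ E) := by
    by_cases hex : ∃ u v, u ≠ a ∧ u ≠ b ∧ v ≠ a ∧ v ≠ b ∧ s(u, v) ∈ E
    · obtain ⟨u, v, hua, hub, hva, hvb, huv⟩ := hex
      exact ⟨u, v, h.isComp_edge hm hua hub hva hvb huv, fun e => absurd e (h.ne_of_mem huv)⟩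
    · obtain ⟨x, y, hc⟩ := h.exists_comp hm (by omega)
      exact ⟨x, y, hc, fun _ u v h1 h2 h3 h4 h5 => hex ⟨u, v, h1, h2, h3, h4, h5⟩⟩
  have j₁ := c₁.isJoin h
  have m₁ := hm.mono (Finset.sdiff_subset (s := E) (t := compEdges a b x₁ y₁))
  have k₁ := c₁.card_sdiff h
  have p₁ := Finset.card_pos.2 ⟨_, j₁.mem⟩
  by_cases hlast : (E \ compEdges a b x₁ y₁).card = 1
  · have hxy : x₁ ≠ y₁ := by
      intro e
      rw [if_pos e] at k₁
      omega
    refine pathDec_of_sdiff_eq c₁.sub (Q := {s(a, b)}) ?_ (pathDec_edge_last ?_)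
    · obtain ⟨e, he⟩ := Finset.card_eq_one.1 hlast
      have := j₁.mem
      rw [he, Finset.mem_singleton] at this
      rw [he, this]
    · have := h.ne
      have := c₁.xa
      have := c₁.xb
      have := c₁.ya
      have := c₁.yb
      simp; grind
  obtain ⟨x₂, y₂, c₂⟩ := j₁.exists_comp m₁ (by omega)
  have j₂ := c₂.isJoin j₁
  have m₂ := m₁.mono (Finset.sdiff_subset (t := compEdges a b x₂ y₂))
  have k₂ := c₂.card_sdiff j₁
  have p₂ := Finset.card_pos.2 ⟨_, j₂.mem⟩
  -- Stopping after two components would make the edge count 2 mod 3, and after three, 1 mod 3.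
  obtain ⟨x₃, y₃, c₃⟩ := j₂.exists_comp m₂ (by split_ifs at k₁ k₂ <;> omega)
  have j₃ := c₃.isJoin j₂
  have m₃ := m₂.mono (Finset.sdiff_subset (t := compEdges a b x₃ y₃))
  have k₃ := c₃.card_sdiff j₂
  have p₃ := Finset.card_pos.2 ⟨_, j₃.mem⟩
  obtain ⟨x₄, y₄, c₄⟩ := j₃.exists_comp m₃ (by split_ifs at k₁ k₂ k₃ <;> omega)
  obtain ⟨c₄, n₄₃⟩ := c₃.of_sdiff c₄
  obtain ⟨c₄, n₄₂⟩ := c₂.of_sdiff c₄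
  obtain ⟨c₃, n₃₂⟩ := c₂.of_sdiff c₃
  have s₂ := c₂.sub
  have s₃ := c₃.sub
  have s₄ := c₄.sub
  obtain ⟨d₂, n₂₁⟩ := c₁.of_sdiff c₂
  obtain ⟨d₃, n₃₁⟩ := c₁.of_sdiff c₃
  obtain ⟨d₄, n₄₁⟩ := c₁.of_sdiff c₄
  have hP : PathDec ((compEdges a b x₂ y₂ ∪ compEdges a b x₃ y₃ ∪ compEdges a b x₄ y₄ :
      Finset (Sym2 U)) : Set (Sym2 U)) := by
    refine pathDec_three_comps h.ne ?_ ?_ ?_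
    · simp [d₂.xa, d₂.xb, d₂.ya, d₂.yb]
    · simpa [d₃.xa, d₃.xb, d₃.ya, d₃.yb] using n₃₂
    · have := d₄.xa
      have := d₄.xb
      have := d₄.ya
      have := d₄.yb
      simp only [List.mem_cons, List.not_mem_nil, or_false] at n₄₂ n₄₃ ⊢
      tauto
  have hsub₁ := Finset.union_subset (Finset.union_subset s₂ s₃) s₄
  have hsub := hsub₁.trans Finset.sdiff_subset
  obtain ⟨P, hPdef⟩ : ∃ P, P = compEdges a b x₂ y₂ ∪ compEdges a b x₃ y₃ ∪ compEdges a b x₄ y₄ :=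
    ⟨_, rfl⟩
  rw [← hPdef] at hP hsub₁ hsub
  have hJ : IsJoin a b (E \ P) := by
    refine h.sdiff (fun hab => (Finset.mem_sdiff.1 (hsub₁ hab)).2.elim ?_) ?_
    · rw [hPdef, Finset.mem_union, Finset.mem_union] at hab
      rcases hab with (hab | hab) | hab
      exacts [(d₂.notMem hab).elim, (d₃.notMem hab).elim, (d₄.notMem hab).elim]
    · intro z hza hzb hz w hw
      simp only [hPdef, Finset.mem_union] at hz ⊢
      have q₂ := d₂.max hza hzb
      have q₃ := d₃.max hza hzb
      have q₄ := d₄.max hza hzb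
      rcases hz with ((hz | hz) | hz) | ((hz | hz) | hz)
      exacts [Or.inl (Or.inl (q₂ (Or.inl hz) w hw)), Or.inl (Or.inr (q₃ (Or.inl hz) w hw)),
        Or.inr (q₄ (Or.inl hz) w hw), Or.inl (Or.inl (q₂ (Or.inr hz) w hw)),
        Or.inl (Or.inr (q₃ (Or.inr hz) w hw)), Or.inr (q₄ (Or.inr hz) w hw)]
  have hne : P.Nonempty := ⟨s(x₂, a), by simp [hPdef, mem_compEdges_left]⟩
  refine (pathDec_or_card_eq h3 ih hP hne hsub hJ).elim (fun hcard => ?_) id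
  -- A remaining triangle contains the first component, which is then a single vertex, having no
  -- room for 5 edges. By its choice, all four components are single vertices.
  have hsubC : compEdges a b x₁ y₁ ⊆ E \ P := by
    intro e he
    exact Finset.mem_sdiff.2 ⟨c₁.sub he, fun he' => (Finset.mem_sdiff.1 (hsub₁ he')).2 he⟩
  have hxy₁ : x₁ = y₁ := by
    by_contra hxy
    have := Finset.card_le_card hsubC
    rw [c₁.card_compEdges h, if_neg hxy] at this
    omega
  have hiso' : ∀ x y, IsComp a b E x y → x = y := by
    intro x y hc
    by_contra hxy
    exact hiso hxy₁ x y hc.xa hc.xb hc.ya hc.yb (hc.sub (by simp [mem_compEdges, hxy]))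
  obtain rfl := hxy₁
  obtain rfl := hiso' _ _ d₂
  obtain rfl := hiso' _ _ d₃
  obtain rfl := hiso' _ _ d₄
  have hE' := hJ.eq_triangle hcard c₁.xa c₁.xb (hsubC mem_compEdges_left)
  have hn : [a, b, x₁, x₂, x₃, x₄].Nodup := by
    have := h.ne
    have := c₁.xa
    have := c₁.xb
    have := d₂.xa
    have := d₂.xb
    have := d₃.xa
    have := d₃.xb
    have := d₄.xa
    have := d₄.xb
    simp at n₂₁ n₃₁ n₃₂ n₄₁ n₄₂ n₄₃ ⊢
    grind
  refine pathDec_of_sdiff_eq hsub hE' ?_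
  convert pathDec_isolated_last hn using 2
  rw [hPdef]
  ext e
  simp only [Finset.mem_union, Finset.mem_insert, Finset.mem_singleton, compEdges, if_true]
  tauto

/-- Strong induction on the number of edges, by the structure of the graph outside `a` and `b`: it
contains a `P4`, or else a vertex of degree at least two, or else is a matching with isolated
vertices. -/
lemma pathDec (h : IsJoin a b E) (h3 : 3 ∣ E.card) (hE : 3 < E.card) :
    PathDec (E : Set (Sym2 U)) := by
  induction hn : E.card using Nat.strong_induction_on generalizing E with | _ n ih =>
  subst hn
  replace ih : ∀ F : Finset (Sym2 U), F.card < E.card → IsJoin a b F → 3 ∣ F.card → 3 < F.card →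
      PathDec (F : Set (Sym2 U)) := fun F hF hJ h3 hc => ih _ hF hJ h3 hc rfl
  by_cases hA : ∃ p q r t, (p ≠ a ∧ p ≠ b) ∧ (q ≠ a ∧ q ≠ b) ∧ (r ≠ a ∧ r ≠ b) ∧ (t ≠ a ∧ t ≠ b) ∧
      [p, q, r, t].Nodup ∧ s(p, q) ∈ E ∧ s(q, r) ∈ E ∧ s(r, t) ∈ E
  · obtain ⟨p, q, r, t, hp, hq, hr, ht, hn, h1, h2, h4⟩ := hA
    obtain ⟨P, hPdef⟩ : ∃ P : Finset (Sym2 U), P = {s(p, q), s(q, r), s(r, t)} := ⟨_, rfl⟩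
    have hP : PathDec (P : Set (Sym2 U)) := by
      simpa [hPdef] using pathDec_path hn
    have hsub : P ⊆ E := by
      simp [hPdef, Finset.insert_subset_iff, h1, h2, h4]
    have hPa : ∀ x, s(x, a) ∉ P := by
      intro x
      simp only [hPdef, Finset.mem_insert, Finset.mem_singleton, Sym2.eq_iff]
      grind
    have hPb : ∀ x, s(x, b) ∉ P := by
      intro x
      simp only [hPdef, Finset.mem_insert, Finset.mem_singleton, Sym2.eq_iff]
      grind
    have hJ : IsJoin a b (E \ P) := by
      refine h.sdiff (hPb a) fun x hxa hxb hx => ?_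
      rcases hx with hx | hx
      exacts [absurd hx (hPa x), absurd hx (hPb x)]
    refine (pathDec_or_card_eq h3 ih hP ⟨s(p, q), by simp [hPdef]⟩ hsub hJ).elim
      (fun hcard => ?_) id
    -- The remainder cannot be a triangle, as both `p` and `q` are still joined to `a`.
    have hpa : s(p, a) ∈ E \ P := Finset.mem_sdiff.2 ⟨h.left p q h1 hp.1 hp.2, hPa p⟩
    have hqa : s(q, a) ∈ E \ P := Finset.mem_sdiff.2 ⟨h.left q r h2 hq.1 hq.2, hPa q⟩
    rw [hJ.eq_triangle hcard hp.1 hp.2 hpa] at hqa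
    have := h.ne_of_mem h1
    simp only [Finset.mem_insert, Finset.mem_singleton, Sym2.eq_iff] at hqa
    grind
  by_cases hB : ∃ c l m, (c ≠ a ∧ c ≠ b) ∧ (l ≠ a ∧ l ≠ b) ∧ (m ≠ a ∧ m ≠ b) ∧ l ≠ m ∧
      s(c, l) ∈ E ∧ s(c, m) ∈ E
  · obtain ⟨c, l, m, hc, hl, hm, hlm, h1, h2⟩ := hB
    have hcl := h.ne_of_mem h1
    have hcm := h.ne_of_mem h2
    have h1' : s(l, c) ∈ E := by rwa [Sym2.eq_swap]
    have h2' : s(m, c) ∈ E := by rwa [Sym2.eq_swap]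
    -- Any further neighbour `w` of `l` would give the path `w l c m` excluded by `hA`.
    have hl' : ∀ w, s(l, w) ∈ E → w = a ∨ w = b ∨ w = c ∨ w = m := by
      intro w hw
      by_contra! hne
      have := h.ne_of_mem hw
      rw [Sym2.eq_swap] at hw
      exact hA ⟨w, l, c, m, ⟨hne.1, hne.2.1⟩, hl, hc, hm, by simp; grind, hw, h1', h2⟩
    have hm' : ∀ w, s(m, w) ∈ E → w = a ∨ w = b ∨ w = c ∨ w = l := by
      intro w hw
      by_contra! hne
      have := h.ne_of_mem hw
      rw [Sym2.eq_swap] at hw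
      exact hA ⟨w, m, c, l, ⟨hne.1, hne.2.1⟩, hm, hc, hl, by simp; grind, hw, h2', h1⟩
    have hca := h.left c l h1 hc.1 hc.2
    have hcb := h.right c l h1 hc.1 hc.2
    have hla := h.left l c h1' hl.1 hl.2
    have hlb := h.right l c h1' hl.1 hl.2
    have hma := h.left m c h2' hm.1 hm.2
    have hmb := h.right m c h2' hm.1 hm.2
    have hab := h.ne
    -- If `lm` is an edge, then `c l m` is a whole component and is removed with its edges to `a`
    -- and `b`. Otherwise `l` and `m` are leaves at `c`; they are removed, and `c` stays.
    by_cases hE' : s(l, m) ∈ E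
    · have hc' : ∀ w, s(c, w) ∈ E → w = a ∨ w = b ∨ w = l ∨ w = m := by
        intro w hw
        by_contra! hne
        have := h.ne_of_mem hw
        rw [Sym2.eq_swap] at hw
        exact hA ⟨w, c, l, m, ⟨hne.1, hne.2.1⟩, hc, hl, hm, by simp; grind, hw, h1, hE'⟩
      have hn : [a, b, c, l, m].Nodup := by simp; grind
      obtain ⟨P, hPdef⟩ : ∃ P : Finset (Sym2 U), P = {s(c, l), s(c, m), s(l, m), s(c, a), s(c, b),
        s(l, a), s(l, b), s(m, a), s(m, b)} := ⟨_, rfl⟩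
      have hP := pathDec_triangle hn
      rw [← hPdef] at hP
      have hsub : P ⊆ E := by
        simp [Finset.insert_subset_iff, *]
      have hPx : ∀ x, x ≠ a → x ≠ b → (s(x, a) ∈ P ∨ s(x, b) ∈ P ↔ x = c ∨ x = l ∨ x = m) := by
        intro x hxa hxb
        simp only [hPdef, Finset.mem_insert, Finset.mem_singleton, Sym2.eq_iff]
        grind
      have hJ : IsJoin a b (E \ P) := by
        refine h.sdiff ?_ fun x hxa hxb hx y hy => ?_
        · simp only [hPdef, Finset.mem_insert, Finset.mem_singleton, Sym2.eq_iff]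
          grind
        · rw [hPx x hxa hxb] at hx
          rcases hx with rfl | rfl | rfl
          · rcases hc' y hy with rfl | rfl | rfl | rfl <;> simp [hPdef]
          · rcases hl' y hy with rfl | rfl | rfl | rfl <;> simp [hPdef]
          · rcases hm' y hy with rfl | rfl | rfl | rfl <;> simp [hPdef]
      refine (pathDec_or_card_eq h3 ih hP ⟨s(c, l), by simp [hPdef]⟩ hsub hJ).elim
        (fun hcard => ?_) id
      obtain ⟨w, hwa, hwb, hw⟩ := hJ.exists_vertex (by omega)
      have hw' := (hPx w hwa hwb).not.1 (fun hor => by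
        have hwb' := hJ.right w a hw hwa hwb
        rw [Finset.mem_sdiff] at hw hwb'
        exact hor.elim hw.2 hwb'.2)
      have hQ := hJ.eq_triangle hcard hwa hwb hw
      refine pathDec_of_sdiff_eq hsub hQ ?_
      rw [hPdef]
      exact pathDec_triangle_last (by simp; grind)
    · have hn : [a, b, c, l, m].Nodup := by simp; grind
      obtain ⟨P, hPdef⟩ : ∃ P : Finset (Sym2 U), P = {s(c, l), s(c, m), s(l, a), s(l, b), s(m, a),
        s(m, b)} := ⟨_, rfl⟩
      have hP := pathDec_leaves hn
      rw [← hPdef] at hP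
      have hsub : P ⊆ E := by
        simp [Finset.insert_subset_iff, *]
      have hPx : ∀ x, x ≠ a → x ≠ b → (s(x, a) ∈ P ∨ s(x, b) ∈ P ↔ x = l ∨ x = m) := by
        intro x hxa hxb
        simp only [hPdef, Finset.mem_insert, Finset.mem_singleton, Sym2.eq_iff]
        grind
      have hE'' : s(m, l) ∉ E := by rwa [Sym2.eq_swap]
      have hJ : IsJoin a b (E \ P) := by
        refine h.sdiff ?_ fun x hxa hxb hx y hy => ?_
        · simp only [hPdef, Finset.mem_insert, Finset.mem_singleton, Sym2.eq_iff]
          grind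
        · rw [hPx x hxa hxb] at hx
          rcases hx with rfl | rfl
          · rcases hl' y hy with rfl | rfl | rfl | rfl
            exacts [by simp [hPdef], by simp [hPdef], by simp [hPdef], absurd hy hE']
          · rcases hm' y hy with rfl | rfl | rfl | rfl
            exacts [by simp [hPdef], by simp [hPdef], by simp [hPdef], absurd hy hE'']
      refine (pathDec_or_card_eq h3 ih hP ⟨s(c, l), by simp [hPdef]⟩ hsub hJ).elim
        (fun hcard => ?_) id
      have hca' : s(c, a) ∈ E \ P := Finset.mem_sdiff.2 ⟨hca, fun hmem => by
        have := (hPx c hc.1 hc.2).1 (Or.inl hmem)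
        tauto⟩
      refine pathDec_of_sdiff_eq hsub (hJ.eq_triangle hcard hc.1 hc.2 hca') ?_
      rw [hPdef]
      exact pathDec_leaves_last hn
  refine h.pathDec_of_isMatch ?_ h3 hE ih
  intro x y z hxa hxb hya hyb hza hzb hxy hxz
  by_contra hyz
  exact hB ⟨x, y, z, ⟨hxa, hxb⟩, ⟨hya, hyb⟩, ⟨hza, hzb⟩, hyz, hxy, hxz⟩

end IsJoin

end JoinDecomposition

/-! ### Every design links to all admissible orders from `v + 2` on -/

section SpectrumTwo

variable {U : Type*}

lemma mem_spectrumTwo [Infinite U] {v n : ℕ} (hv : 1 < v) (hn : v + 2 ≤ n)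
    (h3 : n ≡ 0 [MOD 3] ∨ n ≡ 1 [MOD 3]) : n ∈ spectrumTwo U C4 P4 v := by
  classical
  rintro X 𝓑 rfl h
  obtain ⟨Y, hXY, hY⟩ := Infinite.exists_superset_card_eq X n (by omega)
  obtain ⟨a, b, ha, hb, hab⟩ : ∃ a b, a ∈ Y \ X ∧ b ∈ Y \ X ∧ a ≠ b := by
    have : 1 < (Y \ X).card := by
      rw [Finset.card_sdiff_of_subset hXY]
      omega
    obtain ⟨a, ha, b, hb, hab⟩ := Finset.one_lt_card.1 this
    exact ⟨a, b, ha, hb, hab⟩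
  rw [Finset.mem_sdiff] at ha hb
  have hex : ∀ B : 𝓑, ∃ P : GraphIn U, P ≤ B ∧ Nonempty (P.coe ≃g P4) := by
    intro B
    obtain ⟨p, hp, hB⟩ := exists_eq_blockOf (h.iso B B.2)
    exact ⟨blockOf P4 p hp, hB ▸ blockOf_P4_le_C4 p hp, blockOf_iso _ _ _⟩
  choose f hf hf' using hex
  suffices hrest : PathDec ((completeOn Y).edgeSet \ ⋃ B, (f B).edgeSet) by
    obtain ⟨𝓑', h1, h2⟩ := h.exists_link hXY f hf hf' hrest
    exact ⟨Y, 𝓑', hY, h1, h2⟩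
  have hE0 := h.pathDec_iUnion f hf hf'
  have hE0sub : (⋃ B, (f B).edgeSet) ⊆ (completeEdges X : Set (Sym2 U)) := by
    rw [← edgeSet_completeOn]
    exact Set.iUnion_subset fun B =>
      SimpleGraph.Subgraph.edgeSet_mono ((hf B).trans (h.le B B.2))
  obtain ⟨E0, hE0eq⟩ := ((completeEdges X).finite_toSet.subset hE0sub).exists_finset_coe
  rw [← hE0eq] at hE0 hE0sub ⊢
  rw [Finset.coe_subset] at hE0sub
  have hsub : completeEdges X ⊆ completeEdges Y := by
    intro e
    induction e with | _ x y =>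
    rw [mem_completeEdges, mem_completeEdges]
    exact fun ⟨hx, hy, hxy⟩ => ⟨hXY hx, hXY hy, hxy⟩
  rw [edgeSet_completeOn, ← Finset.coe_sdiff]
  have hE0a : ∀ x y, y ∉ X → s(x, y) ∉ E0 := fun x y hy hxy =>
    hy (mem_completeEdges.1 (hE0sub hxy)).2.1
  have hmem : ∀ x y, y ∉ X → x ∈ Y → y ∈ Y → x ≠ y → s(x, y) ∈ completeEdges Y \ E0 :=
    fun x y hyX hx hy hxy => Finset.mem_sdiff.2 ⟨mem_completeEdges.2 ⟨hx, hy, hxy⟩, hE0a x y hyX⟩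
  -- The deleted paths live on `X`, so no edge at the new points `a` and `b` has been used.
  have hJ : IsJoin a b (completeEdges Y \ E0) := by
    refine ⟨hab, hmem a b hb.2 ha.1 hb.1 hab, ?_, ?_, ?_⟩
    · intro x hx
      exact (mem_completeEdges.1 (Finset.mem_sdiff.1 hx).1).2.2 rfl
    · intro x y hxy hxa _
      exact hmem x a ha.2 (mem_completeEdges.1 (Finset.mem_sdiff.1 hxy).1).1 ha.1 hxa
    · intro x y hxy _ hxb
      exact hmem x b hb.2 (mem_completeEdges.1 (Finset.mem_sdiff.1 hxy).1).1 hb.1 hxb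
  obtain ⟨x, hx, y, hy, hxy⟩ := Finset.one_lt_card.1 hv
  have hne : ∀ {z w}, z ∈ X → w ∉ X → z ≠ w := fun hz hw e => hw (e ▸ hz)
  have hxa := hmem x a ha.2 (hXY hx) ha.1 (hne hx ha.2)
  have hya := hmem y a ha.2 (hXY hy) ha.1 (hne hy ha.2)
  have h3' : 3 ∣ (completeEdges Y \ E0).card := by
    have h1 : (completeEdges Y).card = n.choose 2 := by
      rw [← hY]
      exact Sym2.card_image_offDiag Y
    have h2 := hE0.three_dvd
    have h4 := dvd_choose_of_mod_three h3
    rw [Finset.card_sdiff_of_subset (hE0sub.trans hsub)]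
    omega
  -- The triangle is excluded because `X` has two vertices, both joined to `a`.
  refine hJ.pathDec h3' (lt_of_le_of_ne ?_ fun hcard => ?_)
  · exact Nat.le_of_dvd (Finset.card_pos.2 ⟨_, hJ.mem⟩) h3'
  · rw [hJ.eq_triangle hcard.symm (hne hx ha.2) (hne hx hb.2) hxa] at hya
    have := hne hy hb.2
    have := hne hy ha.2
    simp only [Finset.mem_insert, Finset.mem_singleton, Sym2.eq_iff] at hya
    grind

end SpectrumTwo

/-! ### The cyclic `C4`-design of order `8t + 1` -/

section Cyclic

variable {U : Type*} {t : ℕ}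

open Function

/-- The edge joining `x` and `x + d` in the cyclic labelling `g`. -/
def diffEdge (g : ZMod (8 * t + 1) → U) (d : ℕ) (x : ZMod (8 * t + 1)) : Sym2 U :=
  s(g x, g (x + d))

lemma natCast_inj_of_lt {m n : ℕ} (hm : m < 8 * t + 1) (hn : n < 8 * t + 1)
    (h : (m : ZMod (8 * t + 1)) = n) : m = n := by
  rw [ZMod.natCast_eq_natCast_iff'] at h
  rwa [Nat.mod_eq_of_lt hm, Nat.mod_eq_of_lt hn] at h

lemma natCast_ne_zero_of_lt {m : ℕ} (hpos : 0 < m) (hm : m < 8 * t + 1) :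
    (m : ZMod (8 * t + 1)) ≠ 0 := by
  intro h
  have := natCast_inj_of_lt (n := 0) hm (by omega) (by simpa using h)
  omega

/-- Two labels differ if their difference is `m` with `0 < m < 8 * t + 1`. -/
lemma label_ne {g : ZMod (8 * t + 1) → U} (hg : Injective g) {x y : ZMod (8 * t + 1)} (m : ℕ)
    (hpos : 0 < m) (hm : m < 8 * t + 1) (h : y - x = m) : g x ≠ g y := by
  intro e
  rw [hg e, sub_self] at h
  exact natCast_ne_zero_of_lt hpos hm h.symm

/-- Reading an edge backwards would force `d + d' = 0` modulo `8t + 1`, but `0 < d + d' ≤ 8t`. -/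
lemma diffEdge_inj {g : ZMod (8 * t + 1) → U} (hg : Injective g) {d d' : ℕ}
    {x x' : ZMod (8 * t + 1)} (hd : 0 < d ∧ d ≤ 4 * t) (hd' : 0 < d' ∧ d' ≤ 4 * t)
    (h : diffEdge g d x = diffEdge g d' x') : d = d' ∧ x = x' := by
  rcases Sym2.eq_iff.1 h with ⟨h1, h2⟩ | ⟨h1, h2⟩
  · obtain rfl := hg h1
    exact ⟨natCast_inj_of_lt (by omega) (by omega) (add_left_cancel (hg h2)), rfl⟩
  · have h1 := hg h1
    have h2 := hg h2
    refine absurd ?_ (natCast_ne_zero_of_lt (t := t) (m := d + d') (by omega) (by omega))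
    rw [h1] at h2
    push_cast
    linear_combination h2

/-- One of `q - p` and `p - q` has its representative in the lower half. -/
lemma exists_diffEdge (g : ZMod (8 * t + 1) → U) {p q : ZMod (8 * t + 1)} (h : p ≠ q) :
    ∃ d x, (0 < d ∧ d ≤ 4 * t) ∧ s(g p, g q) = diffEdge g d x := by
  have hlt := ZMod.val_lt (q - p)
  have hpos : 0 < (q - p).val := by
    rw [Nat.pos_iff_ne_zero, ne_eq, ZMod.val_eq_zero, sub_eq_zero]
    exact h.symm
  have hcast : ((q - p).val : ZMod (8 * t + 1)) = q - p := ZMod.natCast_zmod_val _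
  by_cases hle : (q - p).val ≤ 4 * t
  · refine ⟨(q - p).val, p, ⟨hpos, hle⟩, ?_⟩
    rw [diffEdge, hcast]
    simp
  · refine ⟨8 * t + 1 - (q - p).val, q, ⟨by omega, by omega⟩, ?_⟩
    rw [diffEdge, Nat.cast_sub hlt.le, hcast, ZMod.natCast_self, Sym2.eq_swap]
    simp

/-- A cycle with differences `4i+2`, `4i+3`, `4i+4` and `4i+1`. -/
def baseCycle (g : ZMod (8 * t + 1) → U) (i : Fin t) (x : ZMod (8 * t + 1)) : Fin 4 → U :=
  ![g (x + (4 * i + 1 : ℕ)), g (x - 1), g (x - (4 * i + 4 : ℕ)), g x]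

lemma injective_baseCycle {g : ZMod (8 * t + 1) → U} (hg : Injective g) (i : Fin t)
    (x : ZMod (8 * t + 1)) : Injective (baseCycle g i x) := by
  have hi := i.2
  refine injective_cons₄ ?_
  have h1 : g (x - 1) ≠ g (x + (4 * i + 1 : ℕ)) :=
    label_ne hg (4 * i + 2) (by omega) (by omega) (by push_cast; ring)
  have h2 : g (x - (4 * i + 4 : ℕ)) ≠ g (x + (4 * i + 1 : ℕ)) :=
    label_ne hg (8 * i + 5) (by omega) (by omega) (by push_cast; ring)
  have h3 : g x ≠ g (x + (4 * i + 1 : ℕ)) :=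
    label_ne hg (4 * i + 1) (by omega) (by omega) (by push_cast; ring)
  have h4 : g (x - (4 * i + 4 : ℕ)) ≠ g (x - 1) :=
    label_ne hg (4 * i + 3) (by omega) (by omega) (by push_cast; ring)
  have h5 : g (x - 1) ≠ g x :=
    label_ne hg 1 (by omega) (by omega) (by push_cast; ring)
  have h6 : g (x - (4 * i + 4 : ℕ)) ≠ g x :=
    label_ne hg (4 * i + 4) (by omega) (by omega) (by push_cast; ring)
  simp only [List.nodup_cons, List.mem_cons, List.not_mem_nil, or_false, not_or, List.nodup_nil,
    not_false_eq_true, and_true]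
  exact ⟨⟨h1.symm, h2.symm, h3.symm⟩, ⟨h4.symm, h5⟩, h6⟩

/-- The tuple is ordered so that the closing edge, which the path drops, is the one of difference
`4i+1`. -/
lemma mem_edgeSet_basePath {g : ZMod (8 * t + 1) → U} (hg : Injective g) {i : Fin t}
    {x : ZMod (8 * t + 1)} {e : Sym2 U} :
    e ∈ (blockOf P4 _ (injective_baseCycle hg i x)).edgeSet ↔
      e = diffEdge g (4 * i + 2) (x - 1) ∨ e = diffEdge g (4 * i + 3) (x - (4 * i + 4 : ℕ)) ∨
        e = diffEdge g (4 * i + 4) (x - (4 * i + 4 : ℕ)) := by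
  have h1 : diffEdge g (4 * i + 2) (x - 1) = s(baseCycle g i x 0, baseCycle g i x 1) := by
    rw [Sym2.eq_swap, diffEdge,
      show x - 1 + (4 * i + 2 : ℕ) = x + (4 * i + 1 : ℕ) by push_cast; ring]
    rfl
  have h2 : diffEdge g (4 * i + 3) (x - (4 * i + 4 : ℕ)) =
      s(baseCycle g i x 1, baseCycle g i x 2) := by
    rw [Sym2.eq_swap, diffEdge,
      show x - (4 * i + 4 : ℕ) + (4 * i + 3 : ℕ) = x - 1 by push_cast; ring]
    rfl
  have h3 : diffEdge g (4 * i + 4) (x - (4 * i + 4 : ℕ)) =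
      s(baseCycle g i x 2, baseCycle g i x 3) := by
    rw [diffEdge, sub_add_cancel]
    rfl
  rw [mem_edgeSet_blockOf_P4, h1, h2, h3]

lemma mem_edgeSet_baseCycle {g : ZMod (8 * t + 1) → U} (hg : Injective g) {i : Fin t}
    {x : ZMod (8 * t + 1)} {e : Sym2 U} :
    e ∈ (blockOf C4 _ (injective_baseCycle hg i x)).edgeSet ↔
      (e = diffEdge g (4 * i + 2) (x - 1) ∨ e = diffEdge g (4 * i + 3) (x - (4 * i + 4 : ℕ)) ∨
        e = diffEdge g (4 * i + 4) (x - (4 * i + 4 : ℕ))) ∨ e = diffEdge g (4 * i + 1) x := by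
  rw [← mem_edgeSet_basePath hg, mem_edgeSet_blockOf_P4, mem_edgeSet_blockOf_C4, or_assoc, or_assoc]
  rfl

lemma baseCycle_unique {g : ZMod (8 * t + 1) → U} (hg : Injective g) {i j : Fin t}
    {x y : ZMod (8 * t + 1)} {e : Sym2 U}
    (h : e ∈ (blockOf C4 _ (injective_baseCycle hg i x)).edgeSet)
    (h' : e ∈ (blockOf C4 _ (injective_baseCycle hg j y)).edgeSet) : i = j ∧ x = y := by
  have hi := i.2
  have hj := j.2
  rw [mem_edgeSet_baseCycle hg] at h h'
  rcases h with (rfl | rfl | rfl) | rfl <;> rcases h' with (h | h | h) | h <;>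
    obtain ⟨hd, hx⟩ := diffEdge_inj hg (by omega) (by omega) h <;>
    first
    | (exfalso; omega)
    | (obtain rfl : i = j := by omega
       exact ⟨rfl, by simpa using hx⟩)

lemma exists_mem_basePath {g : ZMod (8 * t + 1) → U} (hg : Injective g) {d : ℕ}
    (hd : 0 < d ∧ d ≤ 4 * t) (x : ZMod (8 * t + 1)) (hmod : d % 4 ≠ 1) :
    ∃ i y, diffEdge g d x ∈ (blockOf P4 _ (injective_baseCycle hg i y)).edgeSet := by
  have hi : (d - 1) / 4 < t := by omega
  obtain ⟨i, hidef⟩ : ∃ i, (d - 1) / 4 = i := ⟨_, rfl⟩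
  rw [hidef] at hi
  have hcase : d = 4 * i + 2 ∨ d = 4 * i + 3 ∨ d = 4 * i + 4 := by omega
  rcases hcase with rfl | rfl | rfl
  · exact ⟨⟨i, hi⟩, x + 1, (mem_edgeSet_basePath hg).2 (Or.inl (by simp))⟩
  · exact ⟨⟨i, hi⟩, x + (4 * i + 4 : ℕ), (mem_edgeSet_basePath hg).2 (Or.inr (Or.inl (by simp)))⟩
  · exact ⟨⟨i, hi⟩, x + (4 * i + 4 : ℕ), (mem_edgeSet_basePath hg).2 (Or.inr (Or.inr (by simp)))⟩

lemma exists_mem_baseCycle {g : ZMod (8 * t + 1) → U} (hg : Injective g) {d : ℕ}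
    (hd : 0 < d ∧ d ≤ 4 * t) (x : ZMod (8 * t + 1)) :
    ∃ i y, diffEdge g d x ∈ (blockOf C4 _ (injective_baseCycle hg i y)).edgeSet := by
  by_cases hmod : d % 4 = 1
  · have hi : d / 4 < t := by omega
    refine ⟨⟨d / 4, hi⟩, x, (mem_edgeSet_baseCycle hg).2 (Or.inr ?_)⟩
    simp only
    congr 1
    omega
  · obtain ⟨i, y, h⟩ := exists_mem_basePath hg hd x hmod
    exact ⟨i, y, SimpleGraph.Subgraph.edgeSet_mono (blockOf_P4_le_C4 _ _) h⟩

/-- The edges that are left over when the edges with differences `4i+1` are deleted from the cycles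
of the cyclic design. -/
def leftover (g : ZMod (8 * t + 1) → U) (c m : ℕ) : Set (Sym2 U) :=
  {e | ∃ i x, c ≤ i ∧ i < m ∧ e = diffEdge g (4 * i + 1) x}

/-- Each difference from 1 to `4t` occurs once in one base cycle, so translation covers each edge
once. -/
lemma isDesign_cyclic {g : ZMod (8 * t + 1) → U} (hg : Injective g) :
    IsDesign (completeOn (Finset.univ.map ⟨g, hg⟩)) C4
      (Set.range fun q : Fin t × ZMod (8 * t + 1) => blockOf C4 _ (injective_baseCycle hg q.1 q.2))
    where
  le := by
    rintro _ ⟨⟨i, x⟩, rfl⟩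
    refine le_of_edgeSet_subset (exists_adj_C4 (blockOf_iso _ _ _)) fun e he => ?_
    have hmem : ∀ d y, 0 < d ∧ d ≤ 4 * t →
        diffEdge g d y ∈ (completeOn (Finset.univ.map ⟨g, hg⟩)).edgeSet := by
      intro d y hd
      rw [diffEdge, mem_edgeSet_completeOn]
      exact ⟨by simp, by simp, label_ne hg d hd.1 (by omega) (by ring)⟩
    have hi := i.2
    rw [mem_edgeSet_baseCycle hg] at he
    rcases he with (rfl | rfl | rfl) | rfl <;> exact hmem _ _ ⟨by omega, by omega⟩
  iso := by
    rintro _ ⟨q, rfl⟩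
    exact blockOf_iso _ _ _
  partition := by
    intro e he
    induction e with | _ p q =>
    obtain ⟨hp, hq, hpq⟩ := mem_edgeSet_completeOn.1 he
    simp only [Finset.mem_map, Finset.mem_univ, true_and, Embedding.coeFn_mk] at hp hq
    obtain ⟨p, rfl⟩ := hp
    obtain ⟨q, rfl⟩ := hq
    obtain ⟨d, x, hd, h⟩ := exists_diffEdge g (fun h : p = q => hpq (by rw [h]))
    rw [h]
    obtain ⟨i, y, hiy⟩ := exists_mem_baseCycle hg hd x
    refine ⟨_, ⟨⟨(i, y), rfl⟩, hiy⟩, ?_⟩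
    rintro _ ⟨⟨⟨j, z⟩, rfl⟩, hjz⟩
    obtain ⟨rfl, rfl⟩ := baseCycle_unique hg hiy hjz
    rfl

lemma exists_link_cyclic {g : ZMod (8 * t + 1) → U} (hg : Injective g) {Y : Finset U}
    (hXY : Finset.univ.map ⟨g, hg⟩ ⊆ Y)
    (hrest : PathDec ({e ∈ (completeOn Y).edgeSet | ∀ d x, 0 < d ∧ d ≤ 4 * t → d % 4 ≠ 1 →
      e ≠ diffEdge g d x})) :
    Y.card ∈ spectrumOne U C4 P4 (8 * t + 1) := by
  have h := isDesign_cyclic hg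
  set 𝓑 := Set.range fun q : Fin t × ZMod (8 * t + 1) =>
    blockOf C4 _ (injective_baseCycle hg q.1 q.2)
  choose q hq using fun B : 𝓑 => B.2
  have hlink := h.exists_link hXY (fun B => blockOf P4 _ (injective_baseCycle hg (q B).1 (q B).2))
    (fun B => (blockOf_P4_le_C4 _ _).trans (hq B).le) (fun B => blockOf_iso _ _ _)
  suffices hU : ∀ e, e ∈ ⋃ B : 𝓑, (blockOf P4 _ (injective_baseCycle hg (q B).1 (q B).2)).edgeSet ↔
      ∃ d x, (0 < d ∧ d ≤ 4 * t) ∧ d % 4 ≠ 1 ∧ e = diffEdge g d x by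
    obtain ⟨𝓑', h1, h2⟩ := hlink (by
      convert hrest using 1
      ext e
      rw [Set.mem_sdiff, hU]
      simp only [Set.mem_ofPred_eq, not_exists, not_and, ne_eq])
    exact ⟨_, 𝓑, by simp, h, Y, 𝓑', rfl, h1, h2⟩
  intro e
  constructor
  · intro he
    obtain ⟨B, hB⟩ := Set.mem_iUnion.1 he
    have hi := (q B).1.2
    rw [mem_edgeSet_basePath hg] at hB
    rcases hB with rfl | rfl | rfl
    exacts [⟨_, _, ⟨by omega, by omega⟩, by omega, rfl⟩, ⟨_, _, ⟨by omega, by omega⟩, by omega, rfl⟩,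
      ⟨_, _, ⟨by omega, by omega⟩, by omega, rfl⟩]
  · rintro ⟨d, x, hd, hmod, rfl⟩
    obtain ⟨i, y, hiy⟩ := exists_mem_basePath hg hd x hmod
    refine Set.mem_iUnion.2 ⟨⟨_, ⟨(i, y), rfl⟩⟩, ?_⟩
    -- The parameters picked by `choose` agree with `(i, y)`, since a common edge determines them.
    have hq' := hq ⟨_, ⟨(i, y), rfl⟩⟩
    have hc : diffEdge g d x ∈ (blockOf C4 _ (injective_baseCycle hg i y)).edgeSet :=
      SimpleGraph.Subgraph.edgeSet_mono (blockOf_P4_le_C4 _ _) hiy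
    simp only at hq'
    have hc' := hc
    rw [← hq'] at hc'
    obtain ⟨h1, h2⟩ := baseCycle_unique hg hc hc'
    rw [← h1, ← h2]
    exact hiy

lemma mem_leftover_iff {g : ZMod (8 * t + 1) → U} (hg : Injective g) {e : Sym2 U} :
    e ∈ leftover g 0 t ↔ e ∈ (completeOn (Finset.univ.map ⟨g, hg⟩)).edgeSet ∧
      ∀ d x, 0 < d ∧ d ≤ 4 * t → d % 4 ≠ 1 → e ≠ diffEdge g d x := by
  constructor
  · rintro ⟨i, x, -, hi, rfl⟩
    refine ⟨?_, fun d y hd hmod h => ?_⟩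
    · rw [diffEdge, mem_edgeSet_completeOn]
      exact ⟨by simp, by simp, label_ne hg (4 * i + 1) (by omega) (by omega) (by ring)⟩
    · have := (diffEdge_inj hg ⟨by omega, by omega⟩ hd h).1
      omega
  · rintro ⟨he, h⟩
    induction e with | _ p q =>
    obtain ⟨hp, hq, hpq⟩ := mem_edgeSet_completeOn.1 he
    simp only [Finset.mem_map, Finset.mem_univ, true_and, Embedding.coeFn_mk] at hp hq
    obtain ⟨p, rfl⟩ := hp
    obtain ⟨q, rfl⟩ := hq
    obtain ⟨d, x, hd, h'⟩ := exists_diffEdge g (fun h : p = q => hpq (by rw [h]))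
    have hmod : d % 4 = 1 := by
      by_contra hmod
      exact h d x hd hmod h'
    refine ⟨d / 4, x, by omega, by omega, ?_⟩
    rw [h', show 4 * (d / 4) + 1 = d by omega]

lemma mem_spectrumOne_of_leftover {g : ZMod (8 * t + 1) → U} (hg : Injective g)
    (h : PathDec (leftover g 0 t)) : 8 * t + 1 ∈ spectrumOne U C4 P4 (8 * t + 1) := by
  have := exists_link_cyclic hg (Y := Finset.univ.map ⟨g, hg⟩) subset_rfl (by
    convert h using 1
    ext e
    exact (mem_leftover_iff hg).symm)
  simpa using this

lemma starEdge_ne_diffEdge {g : ZMod (8 * t + 1) → U} {z : U} (hz : ∀ x, g x ≠ z)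
    (x y : ZMod (8 * t + 1)) (d : ℕ) : s(z, g x) ≠ diffEdge g d y := by
  intro hxy
  rcases Sym2.eq_iff.1 hxy with ⟨h, -⟩ | ⟨h, -⟩
  exacts [hz _ h.symm, hz _ h.symm]

lemma mem_spectrumOne_of_leftover_star {g : ZMod (8 * t + 1) → U} (hg : Injective g) {z : U}
    (hz : ∀ x, g x ≠ z) (h : PathDec (leftover g 0 t ∪ Set.range fun x => s(z, g x))) :
    8 * t + 2 ∈ spectrumOne U C4 P4 (8 * t + 1) := by
  classical
  have hzX : z ∉ Finset.univ.map ⟨g, hg⟩ := by simpa using hz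
  have := exists_link_cyclic hg (Y := insert z (Finset.univ.map ⟨g, hg⟩))
    (Finset.subset_insert _ _) (by
    convert h using 1
    ext e
    rw [Set.mem_union, mem_leftover_iff hg]
    simp only [Set.mem_ofPred_eq]
    constructor
    · rintro ⟨he, hne⟩
      induction e with | _ p q =>
      simp only [mem_edgeSet_completeOn, Finset.mem_insert] at he
      obtain ⟨hp, hq, hpq⟩ := he
      rcases hp with rfl | hp
      · obtain ⟨x, -, rfl⟩ := Finset.mem_map.1 (hq.resolve_left hpq.symm)
        exact Or.inr ⟨x, rfl⟩
      rcases hq with rfl | hq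
      · obtain ⟨x, -, rfl⟩ := Finset.mem_map.1 hp
        exact Or.inr ⟨x, Sym2.eq_swap⟩
      · exact Or.inl ⟨mem_edgeSet_completeOn.2 ⟨hp, hq, hpq⟩, hne⟩
    · rintro (⟨he, hne⟩ | ⟨x, rfl⟩)
      · refine ⟨?_, hne⟩
        induction e with | _ p q =>
        rw [mem_edgeSet_completeOn] at he ⊢
        exact ⟨Finset.mem_insert_of_mem he.1, Finset.mem_insert_of_mem he.2.1, he.2.2⟩
      · refine ⟨?_, fun d y _ _ => starEdge_ne_diffEdge hz x y d⟩
        exact mem_edgeSet_completeOn.2 ⟨by simp, by simp, (hz x).symm⟩)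
  rw [Finset.card_insert_of_notMem hzX] at this
  simpa using this

end Cyclic

/-! ### Decomposing the leftover differences, with or without a new point -/

section Leftover

variable {U : Type*} {t : ℕ} {g : ZMod (8 * t + 1) → U}

open Function

/-- The zigzag `x, x + d, x - 4, x + d + 4` has differences `d`, `d + 4`, `d + 8`; its translates
use each edge of these differences once. -/
lemma pathDec_leftover_triples (hg : Injective g) {c s : ℕ} (hs : c + 3 * s ≤ t) :
    PathDec (leftover g c (c + 3 * s)) := by
  have hset : leftover g c (c + 3 * s) = ⋃ q : Fin s × ZMod (8 * t + 1),
      {diffEdge g (4 * (c + 3 * q.1) + 1) q.2,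
        diffEdge g (4 * (c + 3 * q.1 + 1) + 1) (q.2 - (4 : ℕ)),
        diffEdge g (4 * (c + 3 * q.1 + 2) + 1) (q.2 - (4 : ℕ))} := by
    ext e
    simp only [Set.mem_iUnion, Set.mem_insert_iff, Set.mem_singleton_iff]
    constructor
    · rintro ⟨i, x, hi, hi', rfl⟩
      have hk : (i - c) / 3 < s := by omega
      obtain ⟨k, hkdef⟩ : ∃ k, (i - c) / 3 = k := ⟨_, rfl⟩
      rw [hkdef] at hk
      have : i = c + 3 * k ∨ i = c + 3 * k + 1 ∨ i = c + 3 * k + 2 := by omega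
      rcases this with rfl | rfl | rfl
      · exact ⟨(⟨k, hk⟩, x), Or.inl rfl⟩
      · exact ⟨(⟨k, hk⟩, x + (4 : ℕ)), Or.inr (Or.inl (by simp))⟩
      · exact ⟨(⟨k, hk⟩, x + (4 : ℕ)), Or.inr (Or.inr (by simp))⟩
    · rintro ⟨⟨k, x⟩, rfl | rfl | rfl⟩
      · exact ⟨_, _, by omega, by have := k.2; simp only; omega, rfl⟩
      · exact ⟨_, _, by omega, by have := k.2; simp only; omega, rfl⟩
      · exact ⟨_, _, by omega, by have := k.2; simp only; omega, rfl⟩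
  rw [hset]
  refine PathDec.iUnion ?_ ?_
  · rintro ⟨k, x⟩
    have hk := k.2
    obtain ⟨d, hd⟩ : ∃ d, 4 * (c + 3 * (k : ℕ)) + 1 = d := ⟨_, rfl⟩
    have e1 : diffEdge g (4 * (c + 3 * (k : ℕ)) + 1) x = s(g x, g (x + d)) := by
      rw [hd, diffEdge]
    have e2 : diffEdge g (4 * (c + 3 * (k : ℕ) + 1) + 1) (x - (4 : ℕ)) =
        s(g (x + d), g (x - (4 : ℕ))) := by
      rw [Sym2.eq_swap, diffEdge, show x - (4 : ℕ) + ((4 * (c + 3 * (k : ℕ) + 1) + 1 : ℕ) :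
        ZMod (8 * t + 1)) = x + d by rw [← hd]; push_cast; ring]
    have e3 : diffEdge g (4 * (c + 3 * (k : ℕ) + 2) + 1) (x - (4 : ℕ)) =
        s(g (x - (4 : ℕ)), g (x + d + (4 : ℕ))) := by
      rw [diffEdge, show x - (4 : ℕ) + ((4 * (c + 3 * (k : ℕ) + 2) + 1 : ℕ) :
        ZMod (8 * t + 1)) = x + d + (4 : ℕ) by rw [← hd]; push_cast; ring]
    simp only [e1, e2, e3]
    refine pathDec_path ?_
    have h1 : g x ≠ g (x + d) := label_ne hg d (by omega) (by omega) (by ring)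
    have h2 : g (x - (4 : ℕ)) ≠ g x := label_ne hg 4 (by omega) (by omega) (by ring)
    have h3 : g x ≠ g (x + d + (4 : ℕ)) :=
      label_ne hg (d + 4) (by omega) (by omega) (by push_cast; ring)
    have h4 : g (x - (4 : ℕ)) ≠ g (x + d) :=
      label_ne hg (d + 4) (by omega) (by omega) (by push_cast; ring)
    have h5 : g (x + d) ≠ g (x + d + (4 : ℕ)) := label_ne hg 4 (by omega) (by omega) (by ring)
    have h6 : g (x - (4 : ℕ)) ≠ g (x + d + (4 : ℕ)) :=
      label_ne hg (d + 8) (by omega) (by omega) (by push_cast; ring)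
    simp only [List.nodup_cons, List.mem_cons, List.not_mem_nil, or_false, not_or, List.nodup_nil,
      not_false_eq_true, and_true]
    exact ⟨⟨h1, h2.symm, h3⟩, ⟨h4.symm, h5⟩, h6⟩
  · rintro ⟨k, x⟩ ⟨l, y⟩ e he he'
    have hk := k.2
    have hl := l.2
    simp only [Set.mem_insert_iff, Set.mem_singleton_iff] at he he'
    rcases he with rfl | rfl | rfl <;> rcases he' with h | h | h <;>
      obtain ⟨hd, hx⟩ := diffEdge_inj hg (by omega) (by omega) h <;>
      first
      | (exfalso; omega)
      | (obtain rfl : k = l := by omega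
         simpa using hx)

lemma leftover_zero_eq (m n : ℕ) (h : m ≤ n) :
    leftover g 0 n = leftover g 0 m ∪ leftover g m n := by
  ext e
  constructor
  · rintro ⟨i, x, h1, h2, rfl⟩
    by_cases hi : i < m
    · exact Or.inl ⟨i, x, h1, hi, rfl⟩
    · exact Or.inr ⟨i, x, by omega, h2, rfl⟩
  · rintro (⟨i, x, h1, h2, rfl⟩ | ⟨i, x, h1, h2, rfl⟩)
    · exact ⟨i, x, h1, by omega, rfl⟩
    · exact ⟨i, x, by omega, h2, rfl⟩

lemma disjoint_leftover (hg : Injective g) {m n : ℕ} (hn : n ≤ t) :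
    Disjoint (leftover g 0 m) (leftover g m n) := by
  rw [Set.disjoint_left]
  rintro _ ⟨i, x, -, hi, rfl⟩ ⟨j, y, hj, hj', h⟩
  have := (diffEdge_inj hg (by omega) (by omega) h).1
  omega

lemma starEdge_inj (hg : Injective g) {z : U} (hz : ∀ x, g x ≠ z) {x y : ZMod (8 * t + 1)}
    (h : s(z, g x) = s(z, g y)) : x = y := by
  rcases Sym2.eq_iff.1 h with ⟨-, h⟩ | ⟨h, -⟩
  exacts [hg h, (hz _ h.symm).elim]

lemma disjoint_star_leftover {z : U} (hz : ∀ x, g x ≠ z) (m n : ℕ) :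
    Disjoint (Set.range fun x => s(z, g x)) (leftover g m n) := by
  rw [Set.disjoint_left]
  rintro _ ⟨x, rfl⟩ ⟨i, y, -, -, h⟩
  exact starEdge_ne_diffEdge hz x y _ h

/-- When the order is divisible by 3, every label is `3j`, `3j+1` or `3j+2` for a unique `j`. -/
lemma exists_label_eq {m : ℕ} (hm : 8 * t + 1 = 3 * m) (x : ZMod (8 * t + 1)) :
    ∃ j : Fin m, ∃ r < 3, x = (3 * j + r : ℕ) := by
  have hlt := ZMod.val_lt x
  refine ⟨⟨x.val / 3, by omega⟩, x.val % 3, Nat.mod_lt _ (by norm_num), ?_⟩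
  simp only
  rw [Nat.div_add_mod, ZMod.natCast_zmod_val]

lemma label_inj {m : ℕ} (hm : 8 * t + 1 = 3 * m) {j k : Fin m} {r s : ℕ} (hr : r < 3) (hs : s < 3)
    (h : ((3 * j + r : ℕ) : ZMod (8 * t + 1)) = (3 * k + s : ℕ)) : j = k ∧ r = s := by
  have hj := j.2
  have hk := k.2
  have := natCast_inj_of_lt (by omega) (by omega) h
  omega

lemma diffEdge_one (n : ℕ) : diffEdge g 1 (n : ℕ) = s(g (n : ℕ), g ((n + 1 : ℕ))) := by
  rw [diffEdge]
  push_cast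
  rfl

lemma natLabel_ne (hg : Injective g) {n k : ℕ} (hk : 0 < k) (hk' : k < 8 * t + 1) :
    g (n : ℕ) ≠ g ((n + k : ℕ)) :=
  label_ne hg k hk hk' (by push_cast; ring)

lemma mem_leftover_one {e : Sym2 U} : e ∈ leftover g 0 1 ↔ ∃ x, e = diffEdge g 1 x := by
  constructor
  · rintro ⟨i, x, -, hi, rfl⟩
    obtain rfl : i = 0 := by omega
    exact ⟨x, rfl⟩
  · rintro ⟨x, rfl⟩
    exact ⟨0, x, by omega, by omega, rfl⟩

/-- Difference 1 gives a Hamiltonian cycle of length `3m`, cut into consecutive paths of length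
three. For the last `j`, the label `3j + 3` wraps around to 0. -/
lemma pathDec_leftover_one (hg : Injective g) (ht : 0 < t) {m : ℕ} (hm : 8 * t + 1 = 3 * m) :
    PathDec (leftover g 0 1) := by
  have hset : leftover g 0 1 = ⋃ j : Fin m, {diffEdge g 1 (3 * j + 0 : ℕ),
      diffEdge g 1 (3 * j + 1 : ℕ), diffEdge g 1 (3 * j + 2 : ℕ)} := by
    ext e
    simp only [mem_leftover_one, Set.mem_iUnion, Set.mem_insert_iff, Set.mem_singleton_iff]
    constructor
    · rintro ⟨x, rfl⟩
      obtain ⟨j, r, hr, rfl⟩ := exists_label_eq hm x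
      refine ⟨j, ?_⟩
      interval_cases r <;> simp
    · rintro ⟨j, rfl | rfl | rfl⟩ <;> exact ⟨_, rfl⟩
  rw [hset]
  refine PathDec.iUnion (fun j => ?_) ?_
  · rw [diffEdge_one, diffEdge_one, diffEdge_one]
    refine pathDec_path ?_
    have h := fun n k => natLabel_ne hg (n := n) (k := k)
    simp only [List.nodup_cons, List.mem_cons, List.not_mem_nil, or_false, not_or, List.nodup_nil,
      not_false_eq_true, and_true]
    exact ⟨⟨h (3 * j) 1 (by omega) (by omega), h (3 * j) 2 (by omega) (by omega),
      h (3 * j) 3 (by omega) (by omega)⟩, ⟨h (3 * j + 1) 1 (by omega) (by omega),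
      h (3 * j + 1) 2 (by omega) (by omega)⟩, h (3 * j + 2) 1 (by omega) (by omega)⟩
  · intro j k e he he'
    simp only [Set.mem_insert_iff, Set.mem_singleton_iff] at he he'
    rcases he with rfl | rfl | rfl <;> rcases he' with h | h | h <;>
      exact (label_inj hm (by norm_num) (by norm_num)
        (diffEdge_inj hg (by omega) (by omega) h).2).1

/-- Each block of three rim vertices carries six edges of the wheel, split into the paths `z, 3j,
3j+1, 3j+2` and `3j+1, z, 3j+2, 3j+3`. -/
lemma pathDec_wheel (hg : Injective g) (ht : 0 < t) {m : ℕ} (hm : 8 * t + 1 = 3 * m) {z : U}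
    (hz : ∀ x, g x ≠ z) : PathDec ((Set.range fun x => s(z, g x)) ∪ leftover g 0 1) := by
  have hset : (Set.range fun x => s(z, g x)) ∪ leftover g 0 1 = ⋃ j : Fin m,
      ({s(z, g (3 * j + 0 : ℕ)), diffEdge g 1 (3 * j + 0 : ℕ), diffEdge g 1 (3 * j + 1 : ℕ)} ∪
        {s(g (3 * j + 1 : ℕ), z), s(z, g (3 * j + 2 : ℕ)), diffEdge g 1 (3 * j + 2 : ℕ)}) := by
    ext e
    simp only [Set.mem_union, Set.mem_range, mem_leftover_one, Set.mem_iUnion, Set.mem_insert_iff,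
      Set.mem_singleton_iff]
    constructor
    · rintro (⟨x, rfl⟩ | ⟨x, rfl⟩) <;> obtain ⟨j, r, hr, rfl⟩ := exists_label_eq hm x <;>
        refine ⟨j, ?_⟩ <;> interval_cases r
      · exact Or.inl (Or.inl rfl)
      · exact Or.inr (Or.inl Sym2.eq_swap)
      · exact Or.inr (Or.inr (Or.inl rfl))
      · exact Or.inl (Or.inr (Or.inl rfl))
      · exact Or.inl (Or.inr (Or.inr rfl))
      · exact Or.inr (Or.inr (Or.inr rfl))
    · rintro ⟨j, (rfl | rfl | rfl) | (rfl | rfl | rfl)⟩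
      exacts [Or.inl ⟨_, rfl⟩, Or.inr ⟨_, rfl⟩, Or.inr ⟨_, rfl⟩, Or.inl ⟨_, Sym2.eq_swap⟩,
        Or.inl ⟨_, rfl⟩, Or.inr ⟨_, rfl⟩]
  have hns := fun x y d => starEdge_ne_diffEdge (g := g) hz x y d
  have hns' := fun x y d => (starEdge_ne_diffEdge (g := g) hz x y d).symm
  rw [hset]
  refine PathDec.iUnion (fun j => ?_) ?_
  · have h := fun n k => natLabel_ne hg (n := n) (k := k)
    have hz' := fun x => (hz x).symm
    have h01 := h (3 * j) 1 (by omega) (by omega)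
    have h02 := h (3 * j) 2 (by omega) (by omega)
    have h12 := h (3 * j + 1) 1 (by omega) (by omega)
    have h13 := h (3 * j + 1) 2 (by omega) (by omega)
    have h23 := h (3 * j + 2) 1 (by omega) (by omega)
    have hn := fun {a b c d : U} (h1 : a ≠ b) (h2 : a ≠ c) (h3 : a ≠ d) (h4 : b ≠ c) (h5 : b ≠ d)
      (h6 : c ≠ d) => show [a, b, c, d].Nodup by simp [*]
    refine PathDec.union ?_ ?_ ?_
    · rw [diffEdge_one, diffEdge_one]
      exact pathDec_path (hn (hz' _) (hz' _) (hz' _) h01 h02 h12)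
    · rw [diffEdge_one]
      exact pathDec_path (hn (hz _) h12 h13 (hz' _) (hz' _) h23)
    · rw [Set.disjoint_left]
      intro e he he'
      simp only [Set.mem_insert_iff, Set.mem_singleton_iff, Sym2.eq_swap (b := z)] at he he'
      rcases he with rfl | rfl | rfl <;> rcases he' with h | h | h <;>
        first
        | exact hns _ _ _ h
        | exact hns' _ _ _ h
        | exact absurd (label_inj hm (by norm_num) (by norm_num) (starEdge_inj hg hz h)).2
            (by norm_num)
        | exact absurd (label_inj hm (by norm_num) (by norm_num)
            (diffEdge_inj hg (by omega) (by omega) h).2).2 (by norm_num)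
  · intro j k e he he'
    simp only [Set.mem_union, Set.mem_insert_iff, Set.mem_singleton_iff, Sym2.eq_swap (b := z)]
      at he he'
    rcases he with (rfl | rfl | rfl) | (rfl | rfl | rfl) <;>
      rcases he' with (h | h | h) | (h | h | h) <;>
      first
      | exact (hns _ _ _ h).elim
      | exact (hns' _ _ _ h).elim
      | exact (label_inj hm (by norm_num) (by norm_num) (starEdge_inj hg hz h)).1
      | exact (label_inj hm (by norm_num) (by norm_num)
          (diffEdge_inj hg (by omega) (by omega) h).2).1

/-- The translates of the path `z, x, x + 1, x + 6` use one spoke, one edge of difference 1 and one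
of difference 5 each. -/
lemma pathDec_star_leftover_two (hg : Injective g) (ht : 2 ≤ t) {z : U} (hz : ∀ x, g x ≠ z) :
    PathDec ((Set.range fun x => s(z, g x)) ∪ leftover g 0 2) := by
  have hset : (Set.range fun x => s(z, g x)) ∪ leftover g 0 2 = ⋃ x,
      {s(z, g x), diffEdge g 1 x, diffEdge g 5 (x + 1)} := by
    ext e
    simp only [Set.mem_union, Set.mem_range, Set.mem_iUnion, Set.mem_insert_iff,
      Set.mem_singleton_iff]
    constructor
    · rintro (⟨x, rfl⟩ | ⟨i, x, -, hi, rfl⟩)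
      · exact ⟨x, Or.inl rfl⟩
      · interval_cases i
        · exact ⟨x, Or.inr (Or.inl rfl)⟩
        · exact ⟨x - 1, Or.inr (Or.inr (by simp))⟩
    · rintro ⟨x, rfl | rfl | rfl⟩
      · exact Or.inl ⟨_, rfl⟩
      · exact Or.inr ⟨0, x, by omega, by omega, rfl⟩
      · exact Or.inr ⟨1, x + 1, by omega, by omega, rfl⟩
  rw [hset]
  refine PathDec.iUnion (fun x => ?_) ?_
  · have h1 : g x ≠ g (x + (1 : ℕ)) := label_ne hg 1 (by omega) (by omega) (by ring)
    have h2 : g x ≠ g (x + 1 + (5 : ℕ)) := label_ne hg 6 (by omega) (by omega) (by push_cast; ring)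
    have h3 : g (x + (1 : ℕ)) ≠ g (x + 1 + (5 : ℕ)) :=
      label_ne hg 5 (by omega) (by omega) (by push_cast; ring)
    have hn : [z, g x, g (x + (1 : ℕ)), g (x + 1 + (5 : ℕ))].Nodup := by
      simp only [List.nodup_cons, List.mem_cons, List.not_mem_nil, or_false, not_or, List.nodup_nil,
        not_false_eq_true, and_true]
      exact ⟨⟨(hz _).symm, (hz _).symm, (hz _).symm⟩, ⟨h1, h2⟩, h3⟩
    have := pathDec_path hn
    rw [Nat.cast_one] at this
    rwa [diffEdge, diffEdge, Nat.cast_one]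
  · intro x y e he he'
    simp only [Set.mem_insert_iff, Set.mem_singleton_iff] at he he'
    rcases he with rfl | rfl | rfl <;> rcases he' with h | h | h
    · exact starEdge_inj hg hz h
    · exact (starEdge_ne_diffEdge hz _ _ _ h).elim
    · exact (starEdge_ne_diffEdge hz _ _ _ h).elim
    · exact (starEdge_ne_diffEdge hz _ _ _ h.symm).elim
    · exact (diffEdge_inj hg (by omega) (by omega) h).2
    · exact absurd (diffEdge_inj hg (by omega) (by omega) h).1 (by norm_num)
    · exact (starEdge_ne_diffEdge hz _ _ _ h.symm).elim
    · exact absurd (diffEdge_inj hg (by omega) (by omega) h).1 (by norm_num)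
    · exact add_right_cancel (diffEdge_inj hg (by omega) (by omega) h).2

lemma pathDec_star_union (hg : Injective g) {c s : ℕ} (hc : t = c + 3 * s) {z : U}
    (hz : ∀ x, g x ≠ z) (h : PathDec ((Set.range fun x => s(z, g x)) ∪ leftover g 0 c)) :
    PathDec (leftover g 0 t ∪ Set.range fun x => s(z, g x)) := by
  rw [leftover_zero_eq c t (by omega), Set.union_comm, ← Set.union_assoc]
  refine h.union ?_ ?_
  · have := pathDec_leftover_triples hg (c := c) (s := s) hc.ge
    rwa [← hc] at this
  · rw [Set.disjoint_union_left]
    exact ⟨disjoint_star_leftover hz _ _, disjoint_leftover hg le_rfl⟩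

lemma exists_labelling [Infinite U] (t : ℕ) :
    ∃ (g : ZMod (8 * t + 1) → U) (z : U), Injective g ∧ ∀ x, g x ≠ z := by
  let f := Infinite.natEmbedding U
  refine ⟨fun x => f (x.val + 1), f 0, fun x y h => ?_, fun x h => ?_⟩
  · have := f.injective h
    exact ZMod.val_injective _ (by omega)
  · have := f.injective h
    omega

lemma mem_spectrumOne_same [Infinite U] (ht : 0 < t)
    (h : 8 * t + 1 ≡ 0 [MOD 3] ∨ 8 * t + 1 ≡ 1 [MOD 3]) :
    8 * t + 1 ∈ spectrumOne U C4 P4 (8 * t + 1) := by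
  unfold Nat.ModEq at h
  obtain ⟨g, -, hg, -⟩ := exists_labelling (U := U) t
  refine mem_spectrumOne_of_leftover hg ?_
  have hcase : (∃ s, t = 0 + 3 * s) ∨ ∃ s, t = 1 + 3 * s := by
    rcases (by omega : t % 3 = 0 ∨ t % 3 = 1) with h | h
    · exact Or.inl ⟨t / 3, by omega⟩
    · exact Or.inr ⟨t / 3, by omega⟩
  rcases hcase with ⟨s, hs⟩ | ⟨s, hs⟩
  · have := pathDec_leftover_triples hg hs.ge
    rwa [← hs] at this
  · have h1 := pathDec_leftover_triples hg hs.ge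
    rw [← hs] at h1
    rw [leftover_zero_eq 1 t ht]
    exact (pathDec_leftover_one hg ht (m := 8 * s + 3) (by omega)).union h1
      (disjoint_leftover hg le_rfl)

lemma mem_spectrumOne_succ [Infinite U] (ht : 0 < t)
    (h : 8 * t + 2 ≡ 0 [MOD 3] ∨ 8 * t + 2 ≡ 1 [MOD 3]) :
    8 * t + 2 ∈ spectrumOne U C4 P4 (8 * t + 1) := by
  unfold Nat.ModEq at h
  obtain ⟨g, z, hg, hz⟩ := exists_labelling (U := U) t
  refine mem_spectrumOne_of_leftover_star hg hz ?_
  rcases (by omega : t % 3 = 1 ∨ t % 3 = 2) with h | h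
  · exact pathDec_star_union hg (c := 1) (s := t / 3) (by omega) hz
      (pathDec_wheel hg ht (m := 8 * (t / 3) + 3) (by omega) hz)
  · exact pathDec_star_union hg (c := 2) (s := t / 3) (by omega) hz
      (pathDec_star_leftover_two hg (by omega) hz)

end Leftover

theorem theorem4p4 {U : Type*} [Infinite U] (v : ℕ) (hv : 1 < v) (hadm : Admissible U C4 v) :
    spectrumOne U C4 P4 v = {n : ℕ | v ≤ n ∧ (n ≡ 0 [MOD 3] ∨ n ≡ 1 [MOD 3])} ∧
    {n : ℕ | v + 2 ≤ n ∧ (n ≡ 0 [MOD 3] ∨ n ≡ 1 [MOD 3])} ⊆ spectrumTwo U C4 P4 v ∧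
    spectrumTwo U C4 P4 v ⊆ {n : ℕ | v ≤ n ∧ (n ≡ 0 [MOD 3] ∨ n ≡ 1 [MOD 3])} := by
  have h2 : {n : ℕ | v + 2 ≤ n ∧ (n ≡ 0 [MOD 3] ∨ n ≡ 1 [MOD 3])} ⊆ spectrumTwo U C4 P4 v :=
    fun n hn => mem_spectrumTwo hv hn.1 hn.2
  have h21 := spectrumTwo_subset_spectrumOne hadm
  have h1 := spectrumOne_subset (U := U) hv
  refine ⟨h1.antisymm ?_, h2, h21.trans h1⟩
  rintro n ⟨hn, h3⟩
  by_cases hn2 : v + 2 ≤ n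
  · exact h21 (h2 ⟨hn2, h3⟩)
  -- For `n = v` and `n = v + 1` the given design only supplies `v = 8t + 1`; the cyclic design is
  -- linked instead.
  obtain ⟨X, 𝓑, hX, h⟩ := hadm
  obtain ⟨t, ht⟩ := h.exists_eq_eight_mul (Finset.card_pos.1 (by omega))
  obtain rfl : v = 8 * t + 1 := by omega
  rcases (by omega : n = 8 * t + 1 ∨ n = 8 * t + 2) with rfl | rfl
  · exact mem_spectrumOne_same (by omega) h3
  · exact mem_spectrumOne_succ (by omega) h3
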